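/- Let $\mathbb K$ be a field of characteristic $0$. A differential graded Lie algebra (DGLA) over $\mathbb K$ is a complex $(L=\bigoplus_{i\in\mathbb Z}L^i,d)$, $d$ of degree $+1$, with a bilinear bracket satisfying $[L^i,L^j]\subset L^{i+j}$, $[x,y]=-(-1)^{\bar x\bar y}[y,x]$, $[x,[y,z]]=[[x,y],z]+(-1)^{\bar x\bar y}[y,[x,z]]$ and $d[x,y]=[dx,y]+(-1)^{\bar x}[x,dy]$, where $\bar x$ is the degree of a homogeneous $x$; morphisms of DGLAs are the morphisms of complexes that commute with the brackets. Let $\mathbf C$ be the category of nilpotent, finite-dimensional, $\mathbb Z$-graded-commutative associative differential graded $\mathbb K$-algebras (without unit). For a DGLA $L$ and $A\in\mathbf C$, the tensor product of complexes $L\otimes A$ is a DGLA with bracket $[x\otimes a,y\otimes b]=(-1)^{\bar a\bar y}[x,y]\otimes ab$. Put $$MC(L\otimes A)=\{x\in(L\otimes A)^1 \mid dx+\tfrac12[x,x]=0\},$$ and let $\mathrm{Def}_L(A)$ be the quotient of $MC(L\otimes A)$ by the gauge action of the group $\exp((L\otimes A)^0)$, $$e^a x=x+\sum_{n\ge0}\frac{(\mathrm{ad}\,a)^n}{(n+1)!}\bigl([a,x]-da\bigr).$$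 This defines a functor $\mathrm{Def}_L:\mathbf C\to\mathbf{Set}$, the deformation functor of $L$, and every morphism of DGLAs $\phi:L\to N$ induces a natural transformation $\mathrm{Def}_L\to\mathrm{Def}_N$ by $x\mapsto(\phi\otimes\mathrm{id}_A)(x)$. **Corollary 3.5.** If $\phi:L\to N$ is a quasi-isomorphism of DGLAs, that is, a morphism of DGLAs inducing isomorphisms $H^i(L)\to H^i(N)$ for all $i\in\mathbb Z$, then the induced natural transformation $\mathrm{Def}_L\to\mathrm{Def}_N$ is an isomorphism of functors $\mathbf C\to\mathbf{Set}$. -/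

import Mathlib

open CategoryTheory TensorProduct

universe k u v w

noncomputable section

/-! ### Complexes of vector spaces -/

/-- A differential `ℤ`-graded vector space over `K`: the total space of the direct sum of the
homogeneous components `deg i`, with a differential of degree `+1`. -/
structure DGModule (K : Type k) [Field K] where
  carrier : Type u
  [instAddCommGroup : AddCommGroup carrier]
  [instModule : Module K carrier]
  deg : ℤ → Submodule K carrier
  isInternal : DirectSum.IsInternal deg
  d : carrier →ₗ[K] carrier
  d_mem : ∀ {i : ℤ} {x : carrier}, x ∈ deg i → d x ∈ deg (i + 1)
  d_d : ∀ x : carrier, d (d x) = 0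

attribute [instance] DGModule.instAddCommGroup DGModule.instModule

namespace DGModule

variable {K : Type k} [Field K]

/-- A morphism of complexes: a linear map preserving degrees and commuting with differentials. -/
structure Hom (V : DGModule.{k, u} K) (W : DGModule.{k, v} K) where
  toLin : V.carrier →ₗ[K] W.carrier
  map_deg : ∀ {i : ℤ} {x : V.carrier}, x ∈ V.deg i → toLin x ∈ W.deg i
  map_d : ∀ x : V.carrier, toLin (V.d x) = W.d (toLin x)

/-- The cocycles `Zⁱ(V)`. -/
def cocycles (V : DGModule.{k, u} K) (i : ℤ) : Submodule K V.carrier :=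
  V.deg i ⊓ LinearMap.ker V.d

/-- The coboundaries `Bⁱ(V) = d(Vⁱ⁻¹)`. -/
def coboundaries (V : DGModule.{k, u} K) (i : ℤ) : Submodule K V.carrier :=
  (V.deg (i - 1)).map V.d

/-- The cohomology `Hⁱ(V) = Zⁱ(V) / Bⁱ(V)`. -/
abbrev cohomology (V : DGModule.{k, u} K) (i : ℤ) : Type u :=
  V.cocycles i ⧸ (V.coboundaries i).submoduleOf (V.cocycles i)

namespace Hom

variable {V : DGModule.{k, u} K} {W : DGModule.{k, v} K}

/-- The restriction of a morphism of complexes to cocycles. -/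
def cocyclesMap (f : Hom V W) (i : ℤ) : V.cocycles i →ₗ[K] W.cocycles i :=
  f.toLin.restrict (by
    rintro x ⟨hx, hd⟩
    refine ⟨f.map_deg hx, ?_⟩
    have hd' : V.d x = 0 := hd
    show W.d (f.toLin x) = 0
    rw [← f.map_d, hd', map_zero])

/-- The map induced in cohomology. -/
def cohomologyMap (f : Hom V W) (i : ℤ) : V.cohomology i →ₗ[K] W.cohomology i :=
  Submodule.mapQ _ _ (f.cocyclesMap i) (by
    rintro ⟨x, hx⟩ ⟨y, hy, hyx⟩
    exact ⟨f.toLin y, f.map_deg hy, by rw [← f.map_d, hyx]; rfl⟩)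

/-- A quasi-isomorphism: a morphism of complexes inducing isomorphisms in cohomology. -/
def IsQuasiIso (f : Hom V W) : Prop :=
  ∀ i : ℤ, Function.Bijective (f.cohomologyMap i)

end Hom

/-- The decomposition of the total space as the direct sum of its homogeneous components. -/
def decomp (V : DGModule.{k, u} K) : V.carrier ≃ₗ[K] DirectSum ℤ fun i => V.deg i :=
  have h : Function.Bijective (DirectSum.coeLinearMap V.deg) := V.isInternal
  (LinearEquiv.ofBijective (DirectSum.coeLinearMap V.deg) h).symm

theorem decomp_of_mem (V : DGModule.{k, u} K) {i : ℤ} {x : V.carrier} (hx : x ∈ V.deg i) :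
    V.decomp x = DirectSum.lof K ℤ (fun i => V.deg i) i ⟨x, hx⟩ := by
  have h : Function.Bijective (DirectSum.coeLinearMap V.deg) := V.isInternal
  change (LinearEquiv.ofBijective (DirectSum.coeLinearMap V.deg) h).symm x = _
  rw [LinearEquiv.symm_apply_eq]
  simp

/-- The linear endomorphism acting on the component of degree `i` as multiplication by `c i`. -/
def scale (V : DGModule.{k, u} K) (c : ℤ → K) : V.carrier →ₗ[K] V.carrier :=
  (DirectSum.toModule K ℤ V.carrier fun i => c i • (V.deg i).subtype) ∘ₗ V.decomp.toLinearMap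

/-- The map `x ↦ (-1)^{deg x} x`. -/
def sign (V : DGModule.{k, u} K) : V.carrier →ₗ[K] V.carrier :=
  V.scale fun i => (-1) ^ i

/-- The projection onto the sum of the components of even degree. -/
def evenPart (V : DGModule.{k, u} K) : V.carrier →ₗ[K] V.carrier :=
  V.scale fun i => if Even i then 1 else 0

/-- The projection onto the sum of the components of odd degree. -/
def oddPart (V : DGModule.{k, u} K) : V.carrier →ₗ[K] V.carrier :=
  V.scale fun i => if Even i then 0 else 1

theorem scale_of_mem (V : DGModule.{k, u} K) (c : ℤ → K) {i : ℤ} {x : V.carrier}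
    (hx : x ∈ V.deg i) : V.scale c x = c i • x := by
  simp [scale, V.decomp_of_mem hx]

theorem sign_of_mem (V : DGModule.{k, u} K) {i : ℤ} {x : V.carrier}
    (hx : x ∈ V.deg i) : V.sign x = (-1 : K) ^ i • x :=
  V.scale_of_mem _ hx

/-- Two linear maps agreeing on homogeneous elements are equal. -/
theorem hom_ext (V : DGModule.{k, u} K) {M : Type v} [AddCommGroup M] [Module K M]
    {f g : V.carrier →ₗ[K] M} (h : ∀ i, ∀ x ∈ V.deg i, f x = g x) : f = g := by
  ext x
  have hx : x ∈ ⨆ i, V.deg i := by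
    rw [V.isInternal.submodule_iSup_eq_top]; trivial
  induction hx using Submodule.iSup_induction' with
  | mem i x hx => exact h i x hx
  | zero => simp
  | add x y _ _ hx hy => simp [hx, hy]

theorem Hom.map_scale {V : DGModule.{k, u} K} {W : DGModule.{k, v} K} (f : Hom V W)
    (c : ℤ → K) (x : V.carrier) : f.toLin (V.scale c x) = W.scale c (f.toLin x) := by
  have : f.toLin ∘ₗ V.scale c = W.scale c ∘ₗ f.toLin :=
    V.hom_ext fun i x hx => by
      simp [V.scale_of_mem c hx, W.scale_of_mem c (f.map_deg hx)]
  exact LinearMap.congr_fun this x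

/-! ### Tensor products of complexes -/

/-- The component `(V ⊗ W)ⁿ = ⨁ Vⁱ ⊗ Wⁿ⁻ⁱ` of a tensor product of graded vector spaces. -/
def tensorDeg (V : DGModule.{k, u} K) (W : DGModule.{k, v} K) (n : ℤ) :
    Submodule K (V.carrier ⊗[K] W.carrier) :=
  Submodule.span K
    {t | ∃ i j : ℤ, i + j = n ∧ ∃ x ∈ V.deg i, ∃ y ∈ W.deg j, t = x ⊗ₜ[K] y}

theorem tmul_mem_tensorDeg (V : DGModule.{k, u} K) (W : DGModule.{k, v} K) {i j n : ℤ}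
    (h : i + j = n) {x : V.carrier} (hx : x ∈ V.deg i) {y : W.carrier} (hy : y ∈ W.deg j) :
    x ⊗ₜ[K] y ∈ tensorDeg V W n :=
  Submodule.subset_span ⟨i, j, h, x, hx, y, hy, rfl⟩

/-- The grading of a tensor product as a map to a direct sum of copies of it. -/
def tensorSplit (V : DGModule.{k, u} K) (W : DGModule.{k, v} K) :
    V.carrier ⊗[K] W.carrier →ₗ[K] (ℤ →₀ V.carrier ⊗[K] W.carrier) :=
  TensorProduct.lift
    ((DirectSum.toModule K ℤ (W.carrier →ₗ[K] (ℤ →₀ V.carrier ⊗[K] W.carrier)) fun i =>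
      (((DirectSum.toModule K ℤ ((V.deg i) →ₗ[K] (ℤ →₀ V.carrier ⊗[K] W.carrier)) fun j =>
        (((TensorProduct.mk K V.carrier W.carrier).compl₁₂
            (V.deg i).subtype (W.deg j).subtype).compr₂ (Finsupp.lsingle (i + j))).flip) ∘ₗ
        W.decomp.toLinearMap).flip)) ∘ₗ
      V.decomp.toLinearMap)

theorem tensorSplit_tmul (V : DGModule.{k, u} K) (W : DGModule.{k, v} K) {i j : ℤ}
    {x : V.carrier} (hx : x ∈ V.deg i) {y : W.carrier} (hy : y ∈ W.deg j) :
    tensorSplit V W (x ⊗ₜ[K] y) = Finsupp.single (i + j) (x ⊗ₜ[K] y) := by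
  simp [tensorSplit, V.decomp_of_mem hx, W.decomp_of_mem hy]

theorem tensorSplit_of_mem (V : DGModule.{k, u} K) (W : DGModule.{k, v} K) {n : ℤ}
    {t : V.carrier ⊗[K] W.carrier} (ht : t ∈ tensorDeg V W n) :
    tensorSplit V W t = Finsupp.single n t := by
  induction ht using Submodule.span_induction with
  | mem t ht =>
    obtain ⟨i, j, rfl, x, hx, y, hy, rfl⟩ := ht
    exact tensorSplit_tmul V W hx hy
  | zero => simp
  | add x y _ _ hx hy => simp [hx, hy]
  | smul a x _ hx => simp [hx]

theorem tensorDeg_iSup (V : DGModule.{k, u} K) (W : DGModule.{k, v} K) :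
    ⨆ n, tensorDeg V W n = ⊤ := by
  rw [eq_top_iff]
  rintro t -
  have key : (Submodule.mkQ (⨆ n, tensorDeg V W n)) = 0 := by
    apply TensorProduct.ext
    refine V.hom_ext fun i x hx => ?_
    refine W.hom_ext fun j y hy => ?_
    simp only [LinearMap.compr₂ₛₗ_apply, TensorProduct.mk_apply, Submodule.mkQ_apply,
      LinearMap.zero_apply, Submodule.Quotient.mk_eq_zero]
    exact Submodule.mem_iSup_of_mem (i + j) (tmul_mem_tensorDeg V W rfl hx hy)
  rw [← Submodule.Quotient.mk_eq_zero, ← Submodule.mkQ_apply, key, LinearMap.zero_apply]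

theorem tensorDeg_isInternal (V : DGModule.{k, u} K) (W : DGModule.{k, v} K) :
    DirectSum.IsInternal (tensorDeg V W) := by
  constructor
  · rw [← AddMonoidHom.coe_coe (DirectSum.coeAddMonoidHom _), injective_iff_map_eq_zero]
    intro s hs
    have key : ∀ (s : DirectSum ℤ fun n => tensorDeg V W n) (n : ℤ),
        tensorSplit V W (DirectSum.coeLinearMap (tensorDeg V W) s) n = s n := by
      intro s n
      induction s using DirectSum.induction_on with
      | zero => simp
      | of m t =>
        rw [DirectSum.coeLinearMap_of, tensorSplit_of_mem V W t.2, Finsupp.single_apply]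
        split_ifs with h
        · subst h; simp
        · rw [DirectSum.of_eq_of_ne _ _ _ (Ne.symm h)]; rfl
      | add a b ha hb => simp [ha, hb]
    ext n
    rw [← key s n]
    have hs' : DirectSum.coeLinearMap (tensorDeg V W) s = 0 := hs
    simp [hs']
  · have h := tensorDeg_iSup V W
    rw [Submodule.iSup_eq_range_dfinsupp_lsum, LinearMap.range_eq_top] at h
    exact h

/-- The differential `d(x ⊗ y) = dx ⊗ y + (-1)^{deg x} x ⊗ dy`. -/
def tensorD (V : DGModule.{k, u} K) (W : DGModule.{k, v} K) :
    V.carrier ⊗[K] W.carrier →ₗ[K] V.carrier ⊗[K] W.carrier :=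
  TensorProduct.map V.d LinearMap.id + TensorProduct.map V.sign W.d

theorem tensorD_tmul (V : DGModule.{k, u} K) (W : DGModule.{k, v} K) {i : ℤ}
    {x : V.carrier} (hx : x ∈ V.deg i) (y : W.carrier) :
    tensorD V W (x ⊗ₜ[K] y) = V.d x ⊗ₜ[K] y + (-1 : K) ^ i • (x ⊗ₜ[K] W.d y) := by
  simp [tensorD, V.sign_of_mem hx, TensorProduct.smul_tmul']

/-- The tensor product of complexes. -/
def tensor (V : DGModule.{k, u} K) (W : DGModule.{k, v} K) : DGModule.{k, max u v} K where
  carrier := V.carrier ⊗[K] W.carrier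
  deg := tensorDeg V W
  isInternal := tensorDeg_isInternal V W
  d := tensorD V W
  d_mem := by
    intro n t ht
    induction ht using Submodule.span_induction with
    | mem t ht =>
      obtain ⟨i, j, rfl, x, hx, y, hy, rfl⟩ := ht
      rw [tensorD_tmul V W hx]
      exact add_mem (tmul_mem_tensorDeg V W (by ring) (V.d_mem hx) hy)
        (Submodule.smul_mem _ _ (tmul_mem_tensorDeg V W (by ring) hx (W.d_mem hy)))
    | zero => simp
    | add x y _ _ hx hy => rw [map_add]; exact add_mem hx hy
    | smul a x _ hx => rw [map_smul]; exact Submodule.smul_mem _ _ hx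
  d_d := by
    have : tensorD V W ∘ₗ tensorD V W = 0 := by
      apply TensorProduct.ext
      refine V.hom_ext fun i x hx => ?_
      ext y
      simp [tensorD_tmul V W hx, tensorD_tmul V W (V.d_mem hx), V.d_d, W.d_d,
        zpow_add₀ (neg_ne_zero.2 (one_ne_zero (α := K)))]
    exact fun x => LinearMap.congr_fun this x

theorem tensorMap_mem {V V' : DGModule.{k, u} K} {W W' : DGModule.{k, v} K} (f : Hom V V')
    (g : Hom W W') {n : ℤ} {t : V.carrier ⊗[K] W.carrier} (ht : t ∈ tensorDeg V W n) :
    TensorProduct.map f.toLin g.toLin t ∈ tensorDeg V' W' n := by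
  induction ht using Submodule.span_induction with
  | mem t ht =>
    obtain ⟨i, j, rfl, x, hx, y, hy, rfl⟩ := ht
    exact tmul_mem_tensorDeg V' W' rfl (f.map_deg hx) (g.map_deg hy)
  | zero => simp
  | add x y _ _ hx hy => rw [map_add]; exact add_mem hx hy
  | smul a x _ hx => rw [map_smul]; exact Submodule.smul_mem _ _ hx

/-- The tensor product of two morphisms of complexes. -/
def Hom.tensor {V V' : DGModule.{k, u} K} {W W' : DGModule.{k, v} K} (f : Hom V V')
    (g : Hom W W') : Hom (V.tensor W) (V'.tensor W') where
  toLin := TensorProduct.map f.toLin g.toLin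
  map_deg := tensorMap_mem f g
  map_d := by
    have : TensorProduct.map f.toLin g.toLin ∘ₗ tensorD V W =
        tensorD V' W' ∘ₗ TensorProduct.map f.toLin g.toLin := by
      apply TensorProduct.ext
      refine V.hom_ext fun i x hx => ?_
      ext y
      simp [tensorD_tmul V W hx, tensorD_tmul V' W' (f.map_deg hx), f.map_d, g.map_d]
    exact fun x => LinearMap.congr_fun this x

end DGModule

/-! ### Nilpotent finite-dimensional dg-algebras -/

/-- The `n+1`-st power of an algebra without unit with multiplication `m`. -/
def algPow {K : Type k} [Field K] {A : Type u} [AddCommGroup A] [Module K A]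
    (m : A →ₗ[K] A →ₗ[K] A) : ℕ → Submodule K A
  | 0 => ⊤
  | n + 1 => Submodule.map₂ m ⊤ (algPow m n)

/-- The objects of the category `C`: nilpotent finite-dimensional graded-commutative associative
differential graded algebras over `K` (without unit). -/
structure NilpDGA (K : Type k) [Field K] extends DGModule.{k, w} K where
  mul : carrier →ₗ[K] carrier →ₗ[K] carrier
  mul_mem : ∀ {i j : ℤ} {a b : carrier}, a ∈ deg i → b ∈ deg j → mul a b ∈ deg (i + j)
  mul_assoc : ∀ a b c : carrier, mul (mul a b) c = mul a (mul b c)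
  mul_comm : ∀ {i j : ℤ} {a b : carrier}, a ∈ deg i → b ∈ deg j →
    mul a b = (-1 : K) ^ (i * j) • mul b a
  d_mul : ∀ {i : ℤ} {a : carrier} (b : carrier), a ∈ deg i →
    d (mul a b) = mul (d a) b + (-1 : K) ^ i • mul a (d b)
  finiteDimensional : FiniteDimensional K carrier
  nilpotent : ∃ n : ℕ, algPow mul n = ⊥

namespace NilpDGA

variable {K : Type k} [Field K]

/-- Morphisms of dg-algebras. -/
@[ext]
structure Hom (A B : NilpDGA.{k, w} K) extends DGModule.Hom A.toDGModule B.toDGModule where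
  map_mul : ∀ a b : A.carrier, toLin (A.mul a b) = B.mul (toLin a) (toLin b)

instance : Category (NilpDGA.{k, w} K) where
  Hom := Hom
  id A :=
    { toLin := LinearMap.id
      map_deg := fun h => h
      map_d := fun _ => rfl
      map_mul := fun _ _ => rfl }
  comp f g :=
    { toLin := g.toLin ∘ₗ f.toLin
      map_deg := fun h => g.map_deg (f.map_deg h)
      map_d := fun x => by simp [f.map_d, g.map_d]
      map_mul := fun a b => by simp [f.map_mul, g.map_mul] }

end NilpDGA

/-! ### Differential graded Lie algebras -/

/-- A differential graded Lie algebra over `K`. -/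
structure DGLA (K : Type k) [Field K] extends DGModule.{k, u} K where
  bracket : carrier →ₗ[K] carrier →ₗ[K] carrier
  bracket_mem : ∀ {i j : ℤ} {x y : carrier}, x ∈ deg i → y ∈ deg j →
    bracket x y ∈ deg (i + j)
  bracket_skew : ∀ {i j : ℤ} {x y : carrier}, x ∈ deg i → y ∈ deg j →
    bracket x y + (-1 : K) ^ (i * j) • bracket y x = 0
  jacobi : ∀ {i j : ℤ} {x y : carrier} (z : carrier), x ∈ deg i → y ∈ deg j →
    bracket x (bracket y z) =
      bracket (bracket x y) z + (-1 : K) ^ (i * j) • bracket y (bracket x z)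
  d_bracket : ∀ {i : ℤ} {x : carrier} (y : carrier), x ∈ deg i →
    d (bracket x y) = bracket (d x) y + (-1 : K) ^ i • bracket x (d y)

namespace DGLA

variable {K : Type k} [Field K]

/-- Morphisms of differential graded Lie algebras: morphisms of complexes commuting with
brackets. -/
structure Hom (L : DGLA.{k, u} K) (N : DGLA.{k, v} K) extends
    DGModule.Hom L.toDGModule N.toDGModule where
  map_bracket : ∀ x y : L.carrier, toLin (L.bracket x y) = N.bracket (toLin x) (toLin y)

/-- A morphism of differential graded Lie algebras is a quasi-isomorphism if it is one as a
morphism of complexes. -/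
def Hom.IsQuasiIso {L : DGLA.{k, u} K} {N : DGLA.{k, v} K} (φ : Hom L N) : Prop :=
  φ.toHom.IsQuasiIso

/-- The identity morphism. -/
def Hom.id (L : DGLA.{k, u} K) : Hom L L where
  toLin := LinearMap.id
  map_deg := fun h => h
  map_d := fun _ => rfl
  map_bracket := fun _ _ => rfl

/-- The set of Maurer–Cartan elements: `x ∈ L¹` with `dx + ½[x, x] = 0`. -/
def MC (L : DGLA.{k, u} K) : Set L.carrier :=
  {x | x ∈ L.deg 1 ∧ L.d x + (2 : K)⁻¹ • L.bracket x x = 0}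

theorem Hom.map_mem_MC {L : DGLA.{k, u} K} {N : DGLA.{k, v} K} (φ : Hom L N) {x : L.carrier}
    (hx : x ∈ L.MC) : φ.toLin x ∈ N.MC := by
  refine ⟨φ.map_deg hx.1, ?_⟩
  rw [← φ.map_d, ← φ.map_bracket, ← map_smul, ← map_add, hx.2, map_zero]

/-! ### The gauge action -/

/-- The adjoint operator `[a, -]_d` of an element `a` of degree `0` on `L_d = L ⊕ K d`, where `d`
is a new element of degree `1` with `[d, b]_d = d(b)`: the pair `(b, β)` stands for `b + β d`, and
`[a, b + β d]_d = [a, b] - β d(a)`. -/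
def adD (L : DGLA.{k, u} K) (a : L.carrier) : (L.carrier × K) →ₗ[K] (L.carrier × K) :=
  LinearMap.inl K L.carrier K ∘ₗ
    LinearMap.coprod (L.bracket a) (-(LinearMap.toSpanSingleton K L.carrier (L.d a)))

theorem adD_apply (L : DGLA.{k, u} K) (a b : L.carrier) (β : K) :
    L.adD a (b, β) = (L.bracket a b - β • L.d a, 0) := by
  simp [adD, sub_eq_add_neg]

/-- The gauge action `e^a x`: the element `y` of `L` with `y + d = exp([a, -]_d)(x + d)` in
`L ⊕ K d`. It is used only where the exponential series has finitely many nonzero terms. -/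
def gauge (L : DGLA.{k, u} K) (a x : L.carrier) : L.carrier :=
  (∑ᶠ n : ℕ, ((n.factorial : K)⁻¹) • ((L.adD a) ^ n) (x, 1)).1

/-- Two Maurer–Cartan elements `x`, `y` are related if `y = e^a x` for some `a ∈ L⁰`. For `L`
nilpotent every element of the group `exp(L⁰)` is of the form `e^a`, so that this is the orbit
relation of the gauge action. -/
def GaugeRel (L : DGLA.{k, u} K) (x y : L.MC) : Prop :=
  ∃ a ∈ L.deg 0, (y : L.carrier) = L.gauge a x

theorem Hom.map_adD_pow {L : DGLA.{k, u} K} {N : DGLA.{k, v} K} (φ : Hom L N) (a : L.carrier)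
    (n : ℕ) (p : L.carrier × K) :
    (φ.toLin.prodMap LinearMap.id) (((L.adD a) ^ n) p) =
      ((N.adD (φ.toLin a)) ^ n) ((φ.toLin.prodMap LinearMap.id) p) := by
  induction n generalizing p with
  | zero => simp
  | succ n ih =>
    obtain ⟨b, β⟩ := p
    rw [pow_succ, pow_succ, Module.End.mul_apply, Module.End.mul_apply, ih]
    simp [adD_apply, φ.map_bracket, φ.map_d]

theorem Hom.map_gauge {L : DGLA.{k, u} K} {N : DGLA.{k, v} K} (φ : Hom L N) {a : L.carrier}
    (ha : IsNilpotent (L.adD a)) (x : L.carrier) :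
    φ.toLin (L.gauge a x) = N.gauge (φ.toLin a) (φ.toLin x) := by
  obtain ⟨m, hm⟩ := ha
  have hfin : (Function.support fun n : ℕ =>
      ((n.factorial : K)⁻¹) • ((L.adD a) ^ n) (x, 1)).Finite := by
    refine (Set.finite_lt_nat m).subset fun n hn => ?_
    by_contra hmn
    refine hn ?_
    have hmn' : m ≤ n := not_lt.1 hmn
    simp [pow_eq_zero_of_le hmn' hm]
  have h := (φ.toLin.prodMap (LinearMap.id (R := K) (M := K))).toAddMonoidHom.map_finsum hfin
  have h1 := congrArg Prod.fst h
  simp only [LinearMap.toAddMonoidHom_coe, map_smul, φ.map_adD_pow] at h1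
  simpa [gauge] using h1

/-! ### The differential graded Lie algebra `L ⊗ A` -/

/-- The bracket `[x ⊗ a, y ⊗ b] = (-1)^{deg a · deg y} [x, y] ⊗ ab` on `L ⊗ A`, written by
splitting `a` into its parts of even and of odd degree. -/
def tensorBracket (L : DGLA.{k, u} K) (A : NilpDGA.{k, w} K) :
    L.carrier ⊗[K] A.carrier →ₗ[K] L.carrier ⊗[K] A.carrier →ₗ[K] L.carrier ⊗[K] A.carrier :=
  TensorProduct.map₂ L.bracket (A.mul ∘ₗ A.evenPart) +
    TensorProduct.map₂ (L.bracket.compl₂ L.sign) (A.mul ∘ₗ A.oddPart)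

theorem tensorBracket_tmul (L : DGLA.{k, u} K) (A : NilpDGA.{k, w} K) {p j : ℤ}
    (x : L.carrier) {a : A.carrier} (ha : a ∈ A.deg p) {y : L.carrier} (hy : y ∈ L.deg j)
    (b : A.carrier) :
    tensorBracket L A (x ⊗ₜ[K] a) (y ⊗ₜ[K] b) =
      (-1 : K) ^ (p * j) • (L.bracket x y ⊗ₜ[K] A.mul a b) := by
  rcases Int.even_or_odd p with hp | hp
  · simp [tensorBracket, DGModule.evenPart, DGModule.oddPart, A.scale_of_mem _ ha, hp,
      (hp.mul_right j).neg_one_zpow]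
  · have hp' : ¬ Even p := Int.not_even_iff_odd.2 hp
    simp [tensorBracket, DGModule.evenPart, DGModule.oddPart, A.scale_of_mem _ ha, hp',
      L.sign_of_mem hy, zpow_mul, hp.neg_one_zpow, TensorProduct.smul_tmul']

theorem tensor_induction (L : DGLA.{k, u} K) (A : NilpDGA.{k, w} K)
    {M : Type v} [AddCommGroup M] [Module K M]
    {f g : L.carrier ⊗[K] A.carrier →ₗ[K] M}
    (h : ∀ i p, ∀ x ∈ L.deg i, ∀ a ∈ A.deg p, f (x ⊗ₜ[K] a) = g (x ⊗ₜ[K] a)) : f = g := by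
  apply TensorProduct.ext
  refine L.hom_ext fun i x hx => ?_
  refine A.hom_ext fun p a ha => ?_
  exact h i p x hx a ha

/-- To prove a linear identity on `(L ⊗ A)ⁿ` it suffices to consider homogeneous pure tensors. -/
theorem eqOn_tensorDeg (L : DGLA.{k, u} K) (A : NilpDGA.{k, w} K)
    {M : Type v} [AddCommGroup M] [Module K M]
    {f g : L.carrier ⊗[K] A.carrier →ₗ[K] M} {n : ℤ}
    (h : ∀ i p, i + p = n → ∀ x ∈ L.deg i, ∀ a ∈ A.deg p, f (x ⊗ₜ[K] a) = g (x ⊗ₜ[K] a))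
    {t : L.carrier ⊗[K] A.carrier}
    (ht : t ∈ DGModule.tensorDeg L.toDGModule A.toDGModule n) : f t = g t := by
  refine LinearMap.eqOn_span (s := _) ?_ ht
  rintro _ ⟨i, p, hip, x, hx, a, ha, rfl⟩
  exact h i p hip x hx a ha

theorem tensorBracket_mem (L : DGLA.{k, u} K) (A : NilpDGA.{k, w} K) {m n : ℤ}
    {s t : L.carrier ⊗[K] A.carrier}
    (hs : s ∈ DGModule.tensorDeg L.toDGModule A.toDGModule m)
    (ht : t ∈ DGModule.tensorDeg L.toDGModule A.toDGModule n) :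
    tensorBracket L A s t ∈ DGModule.tensorDeg L.toDGModule A.toDGModule (m + n) := by
  induction hs using Submodule.span_induction with
  | mem s hs =>
    obtain ⟨i, p, rfl, x, hx, a, ha, rfl⟩ := hs
    induction ht using Submodule.span_induction with
    | mem t ht =>
      obtain ⟨j, q, rfl, y, hy, b, hb, rfl⟩ := ht
      rw [tensorBracket_tmul L A x ha hy]
      exact Submodule.smul_mem _ _ (DGModule.tmul_mem_tensorDeg _ _ (by ring)
        (L.bracket_mem hx hy) (A.mul_mem ha hb))
    | zero => simp
    | add x y _ _ hx hy => rw [map_add]; exact add_mem hx hy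
    | smul c x _ hx => rw [map_smul]; exact Submodule.smul_mem _ _ hx
  | zero => simp
  | add x y _ _ hx hy => rw [map_add, LinearMap.add_apply]; exact add_mem hx hy
  | smul c x _ hx => rw [map_smul, LinearMap.smul_apply]; exact Submodule.smul_mem _ _ hx

/-- Powers of `-1` with exponents of the same parity agree. -/
theorem neg_one_zpow_congr {m n r : ℤ} (h : m = n + 2 * r) : (-1 : K) ^ m = (-1 : K) ^ n := by
  rw [h, zpow_add₀ (neg_ne_zero.2 one_ne_zero), (even_two_mul r).neg_one_zpow, mul_one]

theorem neg_one_zpow_mul (m n : ℤ) : (-1 : K) ^ m * (-1 : K) ^ n = (-1 : K) ^ (m + n) :=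
  (zpow_add₀ (neg_ne_zero.2 one_ne_zero) m n).symm

theorem tensorBracket_skew (L : DGLA.{k, u} K) (A : NilpDGA.{k, w} K) {m n : ℤ}
    {s t : L.carrier ⊗[K] A.carrier}
    (hs : s ∈ DGModule.tensorDeg L.toDGModule A.toDGModule m)
    (ht : t ∈ DGModule.tensorDeg L.toDGModule A.toDGModule n) :
    tensorBracket L A s t + (-1 : K) ^ (m * n) • tensorBracket L A t s = 0 := by
  refine eqOn_tensorDeg L A (f := (tensorBracket L A).flip t +
    (-1 : K) ^ (m * n) • tensorBracket L A t) (g := 0) ?_ hs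
  rintro i p rfl x hx a ha
  refine eqOn_tensorDeg L A (f := tensorBracket L A (x ⊗ₜ[K] a) +
    (-1 : K) ^ ((i + p) * n) • (tensorBracket L A).flip (x ⊗ₜ[K] a)) (g := 0) ?_ ht
  rintro j q rfl y hy b hb
  simp only [LinearMap.add_apply, LinearMap.smul_apply, LinearMap.flip_apply,
    LinearMap.zero_apply]
  rw [tensorBracket_tmul L A x ha hy, tensorBracket_tmul L A y hb hx, A.mul_comm ha hb,
    eq_neg_of_add_eq_zero_left (L.bracket_skew hx hy)]
  simp only [TensorProduct.neg_tmul, TensorProduct.tmul_smul, ← TensorProduct.smul_tmul',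
    smul_neg, smul_smul, neg_one_zpow_mul]
  rw [neg_add_eq_zero]
  congr 1
  exact (neg_one_zpow_congr (r := q * i) (by ring)).symm

theorem tensorBracket_jacobi (L : DGLA.{k, u} K) (A : NilpDGA.{k, w} K) {m n : ℤ}
    {s t : L.carrier ⊗[K] A.carrier} (r : L.carrier ⊗[K] A.carrier)
    (hs : s ∈ DGModule.tensorDeg L.toDGModule A.toDGModule m)
    (ht : t ∈ DGModule.tensorDeg L.toDGModule A.toDGModule n) :
    tensorBracket L A s (tensorBracket L A t r) =
      tensorBracket L A (tensorBracket L A s t) r +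
        (-1 : K) ^ (m * n) • tensorBracket L A t (tensorBracket L A s r) := by
  refine eqOn_tensorDeg L A (f := (tensorBracket L A).flip (tensorBracket L A t r))
    (g := (tensorBracket L A).flip r ∘ₗ (tensorBracket L A).flip t +
      (-1 : K) ^ (m * n) • tensorBracket L A t ∘ₗ (tensorBracket L A).flip r) ?_ hs
  rintro i p rfl x hx a ha
  refine eqOn_tensorDeg L A
    (f := tensorBracket L A (x ⊗ₜ[K] a) ∘ₗ (tensorBracket L A).flip r)
    (g := (tensorBracket L A).flip r ∘ₗ tensorBracket L A (x ⊗ₜ[K] a) +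
      (-1 : K) ^ ((i + p) * n) •
        (tensorBracket L A).flip (tensorBracket L A (x ⊗ₜ[K] a) r)) ?_ ht
  rintro j q rfl y hy b hb
  refine LinearMap.congr_fun (f := tensorBracket L A (x ⊗ₜ[K] a) ∘ₗ tensorBracket L A (y ⊗ₜ[K] b))
    (g := tensorBracket L A (tensorBracket L A (x ⊗ₜ[K] a) (y ⊗ₜ[K] b)) +
      (-1 : K) ^ ((i + p) * (j + q)) •
        tensorBracket L A (y ⊗ₜ[K] b) ∘ₗ tensorBracket L A (x ⊗ₜ[K] a)) ?_ r
  refine tensor_induction L A fun l o z hz c hc => ?_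
  have hab : A.mul b (A.mul a c) = (-1 : K) ^ (q * p) • A.mul a (A.mul b c) := by
    rw [← A.mul_assoc, A.mul_comm hb ha, map_smul, LinearMap.smul_apply, A.mul_assoc]
  simp only [LinearMap.add_apply, LinearMap.smul_apply, LinearMap.comp_apply, map_smul,
    tensorBracket_tmul L A x ha hy, tensorBracket_tmul L A y hb hz,
    tensorBracket_tmul L A x ha hz, tensorBracket_tmul L A x ha (L.bracket_mem hy hz),
    tensorBracket_tmul L A y hb (L.bracket_mem hx hz),
    tensorBracket_tmul L A _ (A.mul_mem ha hb) hz, L.jacobi z hx hy, hab, A.mul_assoc,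
    TensorProduct.add_tmul, TensorProduct.tmul_smul, ← TensorProduct.smul_tmul', smul_add,
    smul_smul, neg_one_zpow_mul]
  congr 1
  · congr 1
    exact neg_one_zpow_congr (r := 0) (by ring)
  · congr 1
    exact (neg_one_zpow_congr (r := q * i + p * q) (by ring)).symm

theorem tensorD_bracket (L : DGLA.{k, u} K) (A : NilpDGA.{k, w} K) {m : ℤ}
    {s : L.carrier ⊗[K] A.carrier} (t : L.carrier ⊗[K] A.carrier)
    (hs : s ∈ DGModule.tensorDeg L.toDGModule A.toDGModule m) :
    DGModule.tensorD L.toDGModule A.toDGModule (tensorBracket L A s t) =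
      tensorBracket L A (DGModule.tensorD L.toDGModule A.toDGModule s) t +
        (-1 : K) ^ m •
          tensorBracket L A s (DGModule.tensorD L.toDGModule A.toDGModule t) := by
  set D := DGModule.tensorD L.toDGModule A.toDGModule with hD
  refine eqOn_tensorDeg L A (f := D ∘ₗ (tensorBracket L A).flip t)
    (g := (tensorBracket L A).flip t ∘ₗ D +
      (-1 : K) ^ m • (tensorBracket L A).flip (D t)) ?_ hs
  rintro i p rfl x hx a ha
  refine LinearMap.congr_fun (f := D ∘ₗ tensorBracket L A (x ⊗ₜ[K] a))
    (g := tensorBracket L A (D (x ⊗ₜ[K] a)) +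
      (-1 : K) ^ (i + p) • tensorBracket L A (x ⊗ₜ[K] a) ∘ₗ D) ?_ t
  refine tensor_induction L A fun j q y hy b hb => ?_
  simp only [LinearMap.add_apply, LinearMap.smul_apply, LinearMap.comp_apply, map_smul, map_add,
    hD, DGModule.tensorD_tmul _ _ hx, DGModule.tensorD_tmul _ _ hy,
    tensorBracket_tmul L A x ha hy, tensorBracket_tmul L A (L.d x) ha hy,
    tensorBracket_tmul L A x (A.d_mem ha) hy, tensorBracket_tmul L A x ha (L.d_mem hy),
    DGModule.tensorD_tmul _ _ (L.bracket_mem hx hy), L.d_bracket y hx, A.d_mul b ha,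
    TensorProduct.add_tmul, TensorProduct.tmul_add, TensorProduct.tmul_smul,
    ← TensorProduct.smul_tmul', smul_add, smul_smul, neg_one_zpow_mul]
  have e1 : (-1 : K) ^ (i + p + p * (j + 1)) = (-1 : K) ^ (p * j + i) :=
    neg_one_zpow_congr (r := p) (by ring)
  have e2 : (-1 : K) ^ (i + (p + 1) * j) = (-1 : K) ^ (p * j + (i + j)) :=
    neg_one_zpow_congr (r := 0) (by ring)
  have e3 : (-1 : K) ^ (i + p + (j + p * j)) = (-1 : K) ^ (p * j + (i + j + p)) :=
    neg_one_zpow_congr (r := 0) (by ring)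
  rw [e1, e2, e3]
  abel

/-- The differential graded Lie algebra `L ⊗ A`. -/
def tensor (L : DGLA.{k, u} K) (A : NilpDGA.{k, w} K) : DGLA.{k, max u w} K where
  toDGModule := L.toDGModule.tensor A.toDGModule
  bracket := tensorBracket L A
  bracket_mem := tensorBracket_mem L A
  bracket_skew := tensorBracket_skew L A
  jacobi := tensorBracket_jacobi L A
  d_bracket := tensorD_bracket L A

/-- The morphism `L ⊗ A → N ⊗ B` induced by `L → N` and `A → B`. -/
def Hom.tensor {L N : DGLA.{k, u} K} {A B : NilpDGA.{k, w} K} (φ : Hom L N) (f : A ⟶ B) :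
    Hom (L.tensor A) (N.tensor B) where
  toHom := DGModule.Hom.tensor φ.toHom f.toHom
  map_bracket := by
    intro s t
    let F := TensorProduct.map φ.toLin f.toLin
    refine LinearMap.congr_fun₂ (f := (tensorBracket L A).compr₂ F)
      (g := (tensorBracket N B).compl₁₂ F F) ?_ s t
    refine tensor_induction L A fun i p x hx a ha => ?_
    refine tensor_induction L A fun j q y hy b hb => ?_
    simp [F, tensorBracket_tmul L A x ha hy,
      tensorBracket_tmul N B (φ.toLin x) (f.map_deg ha) (φ.map_deg hy), φ.map_bracket, f.map_mul]

/-- The subspace `L ⊗ Aⁿ⁺¹` of `L ⊗ A`. -/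
def tensorPow (L : DGLA.{k, u} K) (A : NilpDGA.{k, w} K) (n : ℕ) :
    Submodule K (L.carrier ⊗[K] A.carrier) :=
  Submodule.map₂ (TensorProduct.mk K L.carrier A.carrier) ⊤ (algPow A.mul n)

theorem tensorBracket_mem_tensorPow (L : DGLA.{k, u} K) (A : NilpDGA.{k, w} K) {n : ℕ}
    (s : L.carrier ⊗[K] A.carrier) {t : L.carrier ⊗[K] A.carrier} (ht : t ∈ tensorPow L A n) :
    tensorBracket L A s t ∈ tensorPow L A (n + 1) := by
  have : tensorPow L A n ≤ (tensorPow L A (n + 1)).comap (tensorBracket L A s) := by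
    refine Submodule.map₂_le.2 fun y _ b hb => ?_
    rw [Submodule.mem_comap]
    induction s using TensorProduct.induction_on with
    | zero => simp
    | add s s' hs hs' => rw [map_add, LinearMap.add_apply]; exact add_mem hs hs'
    | tmul x a =>
      have key : ∀ (z : L.carrier) (c : A.carrier),
          z ⊗ₜ[K] A.mul c b ∈ tensorPow L A (n + 1) := fun z c =>
        Submodule.apply_mem_map₂ _ Submodule.mem_top
          (Submodule.apply_mem_map₂ _ Submodule.mem_top hb)
      exact add_mem (key _ _) (key _ _)
  exact this ht

/-- The adjoint operators on `L ⊗ A` extended to `(L ⊗ A) ⊕ K d` are nilpotent, so that the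
gauge action on `L ⊗ A` is given by finite sums. -/
theorem isNilpotent_adD (L : DGLA.{k, u} K) (A : NilpDGA.{k, w} K) (s : (L.tensor A).carrier) :
    IsNilpotent ((L.tensor A).adD s) := by
  obtain ⟨m, hm⟩ := A.nilpotent
  have key : ∀ (n : ℕ) (p : (L.tensor A).carrier × K),
      ∃ t ∈ tensorPow L A n, (((L.tensor A).adD s) ^ (n + 1)) p = (t, 0) := by
    intro n
    induction n with
    | zero =>
      rintro ⟨t, β⟩
      refine ⟨(L.tensor A).bracket s t - β • (L.tensor A).d s, ?_, by
        rw [zero_add, pow_one]; exact (L.tensor A).adD_apply s t β⟩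
      have : tensorPow L A 0 = ⊤ := TensorProduct.map₂_mk_top_top_eq_top K _ _
      rw [this]
      exact Submodule.mem_top
    | succ n ih =>
      intro p
      obtain ⟨t, ht, hp⟩ := ih p
      refine ⟨tensorBracket L A s t, tensorBracket_mem_tensorPow L A s ht, ?_⟩
      rw [pow_succ', Module.End.mul_apply, hp]
      refine ((L.tensor A).adD_apply s t 0).trans ?_
      rw [zero_smul, sub_zero]
      rfl
  refine ⟨m + 1, LinearMap.ext fun p => ?_⟩
  obtain ⟨t, ht, hp⟩ := key m p
  have h0 : tensorPow L A m = ⊥ := by rw [tensorPow, hm, Submodule.map₂_bot_right]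
  rw [h0] at ht
  rw [hp, (Submodule.mem_bot K).1 ht]
  rfl

/-! ### The deformation functor -/

/-- The set `Def_L(A)` of Maurer–Cartan elements of `L ⊗ A` modulo the gauge action. -/
def DefSet (L : DGLA.{k, u} K) (A : NilpDGA.{k, w} K) : Type (max u w) :=
  Quot (GaugeRel (L.tensor A))

/-- The map `Def_L(A) → Def_N(B)` induced by `L → N` and `A → B`. -/
def DefSet.map {L N : DGLA.{k, u} K} {A B : NilpDGA.{k, w} K} (φ : Hom L N) (f : A ⟶ B) :
    DefSet L A → DefSet N B :=
  Quot.map (fun x => ⟨(φ.tensor f).toLin x, (φ.tensor f).map_mem_MC x.2⟩) (by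
    rintro x y ⟨a, ha, hy⟩
    exact ⟨(φ.tensor f).toLin a, (φ.tensor f).map_deg ha, by
      simp only [hy, (φ.tensor f).map_gauge (isNilpotent_adD L A a)]⟩)

/-- The deformation functor `Def_L : C → Set` of a differential graded Lie algebra `L`. -/
def Def (L : DGLA.{k, u} K) : NilpDGA.{k, w} K ⥤ Type (max u w) where
  obj A := DefSet L A
  map f := ↾(DefSet.map (Hom.id L) f)
  map_id A := by
    ext x
    induction x using Quot.ind with | mk x =>
    refine congrArg (Quot.mk _) (Subtype.ext ?_)
    exact LinearMap.congr_fun TensorProduct.map_id _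
  map_comp f g := by
    ext x
    induction x using Quot.ind with | mk x =>
    refine congrArg (Quot.mk _) (Subtype.ext ?_)
    exact LinearMap.congr_fun
      (TensorProduct.map_comp LinearMap.id g.toLin LinearMap.id f.toLin) _

/-- The natural transformation `Def_L → Def_N` induced by a morphism `L → N`. -/
def Hom.defMap {L N : DGLA.{k, u} K} (φ : Hom L N) : Def.{k, u, w} L ⟶ Def.{k, u, w} N where
  app A := ↾(DefSet.map φ (𝟙 A))
  naturality A B f := by
    ext x
    induction x using Quot.ind with | mk x =>
    refine congrArg (Quot.mk _) (Subtype.ext ?_)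
    refine (LinearMap.congr_fun
      (TensorProduct.map_comp φ.toLin LinearMap.id LinearMap.id f.toLin) _).symm.trans ?_
    exact LinearMap.congr_fun
      (TensorProduct.map_comp LinearMap.id f.toLin φ.toLin LinearMap.id) _

end DGLA

end

/-! The morphism `φ` is factored through its mapping path object `P`, the pairs `(x, f)` in `L ×
N[t, dt]` with `φ x = f(0)`. Constant paths give `L → P`; this is a section of the projection `P →
L`, and followed by evaluation at `t = 1` it is `φ`. The projection is always a trivial fibration,
meaning surjective with contractible kernel (`mappingPath_fst_isTrivialFibration`). The evaluation
is one when `φ` is a quasi-isomorphism (`mappingPathEnd_isTrivialFibration`). If trivial fibrations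
induce bijections on deformations, then so does the section, by two-out-of-three, and hence so does
`φ`.

For a trivial fibration, a contraction `σ` of the kernel tensors with `A` to a contraction that
respects the finite filtration of `L ⊗ A` by the powers of `A`. Brackets raise this filtration, so
two successive approximations terminate. A lift `x` of a Maurer–Cartan element is improved to `x -
σ(c)`, where `c` is its curvature; the Bianchi identity puts the new curvature one step deeper
(`Hom.exists_MC_lift`). Two Maurer–Cartan elements `x`, `z` with the same image are brought closer
by acting on `z` with `σ(z - x)` (`Hom.gauge_equiv_of_map_eq`). This gives surjectivity and
injectivity at once, with no obstruction theory for small extensions.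

Characteristic zero enters through the exponential, the identity `[x, [x, x]] = 0` for `x` of degree
one, and integration of polynomials. -/

noncomputable section

/-! ### Homogeneous components and signs. -/

namespace DGModule

variable {K : Type k} [Field K]

/-- A family of submodules with compatible projections whose sum is everything is a direct sum
decomposition. -/
theorem isInternal_of_proj {M : Type u} [AddCommGroup M] [Module K M] (deg : ℤ → Submodule K M)
    (π : ℤ → M →ₗ[K] M) (hid : ∀ i, ∀ x ∈ deg i, π i x = x)
    (hne : ∀ i j, j ≠ i → ∀ x ∈ deg j, π i x = 0) (hsup : ∀ x, x ∈ ⨆ i, deg i) :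
    DirectSum.IsInternal deg := by
  constructor
  · rw [← AddMonoidHom.coe_coe (DirectSum.coeAddMonoidHom _), injective_iff_map_eq_zero]
    intro s hs
    have key : ∀ (s : DirectSum ℤ fun n => deg n) (n : ℤ),
        π n (DirectSum.coeLinearMap deg s) = s n := by
      intro s n
      induction s using DirectSum.induction_on with
      | zero => simp
      | of m t =>
        rw [DirectSum.coeLinearMap_of]
        by_cases h : m = n
        · subst h; simp [hid m t t.2]
        · rw [DirectSum.of_eq_of_ne _ _ _ (Ne.symm h), hne n m h t t.2]; rfl
      | add a b ha hb => simp [ha, hb]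
    ext n
    rw [← key s n]
    have hs' : DirectSum.coeLinearMap deg s = 0 := hs
    simp [hs']
  · have h : ⨆ i, deg i = ⊤ := eq_top_iff.2 fun x _ => hsup x
    rw [Submodule.iSup_eq_range_dfinsupp_lsum, LinearMap.range_eq_top] at h
    exact h

/-- The projection to the component of degree `i`. -/
def proj (V : DGModule.{k, u} K) (i : ℤ) : V.carrier →ₗ[K] V.carrier :=
  V.scale fun j => if j = i then 1 else 0

theorem proj_of_mem (V : DGModule.{k, u} K) {i : ℤ} {x : V.carrier} (hx : x ∈ V.deg i) :
    V.proj i x = x := by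
  simp [proj, V.scale_of_mem _ hx]

theorem proj_of_mem_ne (V : DGModule.{k, u} K) {i j : ℤ} (hij : j ≠ i) {x : V.carrier}
    (hx : x ∈ V.deg j) : V.proj i x = 0 := by
  simp [proj, V.scale_of_mem _ hx, hij]

theorem mem_iSup_deg (V : DGModule.{k, u} K) (x : V.carrier) : x ∈ ⨆ i, V.deg i := by
  rw [V.isInternal.submodule_iSup_eq_top]; trivial

theorem proj_mem (V : DGModule.{k, u} K) (i : ℤ) (x : V.carrier) : V.proj i x ∈ V.deg i := by
  have h : (V.deg i).mkQ ∘ₗ V.proj i = 0 := V.hom_ext fun j x hx => by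
    by_cases hij : j = i
    · subst hij
      simp [V.proj_of_mem hx, hx]
    · simp [V.proj_of_mem_ne hij hx]
  have := LinearMap.congr_fun h x
  simpa using this

/-- All larger index sets are allowed so that two elements can be decomposed over a common one, as
sums and fibre products require. -/
theorem exists_sum_proj (V : DGModule.{k, u} K) (x : V.carrier) :
    ∃ s : Finset ℤ, ∀ t, s ⊆ t → ∑ i ∈ t, V.proj i x = x := by
  have hx := V.mem_iSup_deg x
  induction hx using Submodule.iSup_induction' with
  | mem i x hx =>
    refine ⟨{i}, fun t ht => ?_⟩
    rw [Finset.sum_eq_single_of_mem i (ht (Finset.mem_singleton_self i))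
      fun j _ hji => V.proj_of_mem_ne hji.symm hx, V.proj_of_mem hx]
  | zero => exact ⟨∅, fun t _ => by simp⟩
  | add x y _ _ hx hy =>
    classical
    obtain ⟨s, hs⟩ := hx
    obtain ⟨s', hs'⟩ := hy
    refine ⟨s ∪ s', fun t ht => ?_⟩
    simp_rw [map_add]
    rw [Finset.sum_add_distrib, hs t (Finset.union_subset_left ht),
      hs' t (Finset.union_subset_right ht)]

theorem Hom.map_proj {V : DGModule.{k, u} K} {W : DGModule.{k, v} K} (f : Hom V W)
    (i : ℤ) (x : V.carrier) : f.toLin (V.proj i x) = W.proj i (f.toLin x) :=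
  f.map_scale _ x

/-- A surjective morphism of complexes is surjective in every degree. -/
theorem Hom.exists_lift {V : DGModule.{k, u} K} {W : DGModule.{k, v} K} (f : Hom V W)
    (hf : Function.Surjective f.toLin) {i : ℤ} {y : W.carrier} (hy : y ∈ W.deg i) :
    ∃ x ∈ V.deg i, f.toLin x = y := by
  obtain ⟨x, rfl⟩ := hf y
  exact ⟨V.proj i x, V.proj_mem i x, by rw [f.map_proj, W.proj_of_mem hy]⟩

/-- Two linear maps agreeing on the homogeneous elements of the kernel of a morphism of complexes
agree on the kernel. -/
theorem Hom.eqOn_ker {V : DGModule.{k, u} K} {W : DGModule.{k, v} K} (p : Hom V W)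
    {M : Type w} [AddCommGroup M] [Module K M] {f g : V.carrier →ₗ[K] M}
    (h : ∀ i, ∀ x ∈ V.deg i, p.toLin x = 0 → f x = g x) {x : V.carrier} (hx : p.toLin x = 0) :
    f x = g x := by
  obtain ⟨s, hs⟩ := V.exists_sum_proj x
  rw [← hs s subset_rfl, map_sum, map_sum]
  refine Finset.sum_congr rfl fun i _ => h i _ (V.proj_mem i x) ?_
  rw [p.map_proj, hx, map_zero]

theorem sign_mem (V : DGModule.{k, u} K) {i : ℤ} {x : V.carrier} (hx : x ∈ V.deg i) :
    V.sign x ∈ V.deg i := by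
  rw [V.sign_of_mem hx]; exact Submodule.smul_mem _ _ hx

theorem sign_sign (V : DGModule.{k, u} K) (x : V.carrier) : V.sign (V.sign x) = x := by
  have : V.sign ∘ₗ V.sign = LinearMap.id := V.hom_ext fun i x hx => by
    have h1 : (-1 : K) ^ i * (-1) ^ i = 1 := by
      rw [← mul_zpow]; simp
    simp [V.sign_of_mem hx, smul_smul, h1]
  exact LinearMap.congr_fun this x

theorem d_sign (V : DGModule.{k, u} K) (x : V.carrier) : V.d (V.sign x) = - V.sign (V.d x) := by
  have : V.d ∘ₗ V.sign = - (V.sign ∘ₗ V.d) := V.hom_ext fun i x hx => by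
    simp [V.sign_of_mem hx, V.sign_of_mem (V.d_mem hx),
      zpow_add₀ (neg_ne_zero.2 (one_ne_zero (α := K)))]
  exact LinearMap.congr_fun this x

end DGModule

/-! ### Exponentials of derivations and the gauge action. -/

/-- The exponential of a derivation is compatible with the bilinear map it derives. -/
theorem exp_of_derivation {R V W : Type*} [CommRing R] [AddCommGroup V] [Module R V]
    [AddCommGroup W] [Module R W] [Module ℚ V] [Module ℚ W]
    (B : V →ₗ[R] V →ₗ[R] W) (D : Module.End R V) (E : Module.End R W)
    (h : ∀ x y, E (B x y) = B (D x) y + B x (D y)) (hD : IsNilpotent D) (hE : IsNilpotent E)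
    (x y : V) :
    IsNilpotent.exp E (B x y) = B (IsNilpotent.exp D x) (IsNilpotent.exp D y) := by
  -- The operators `1 ⊗ D` and `D ⊗ 1` commute, so the exponential of their sum is the product of
  -- their exponentials; the map induced by `B` intertwines that sum with `E`.
  let DL : Module.End R (V ⊗[R] V) := D.lTensor V
  let DR : Module.End R (V ⊗[R] V) := D.rTensor V
  have h_nilL : IsNilpotent DL := hD.map <| Module.End.lTensorAlgHom R V V
  have h_nilR : IsNilpotent DR := hD.map <| Module.End.rTensorAlgHom R V V
  have h_comm : Commute DL DR := by ext; simp [DL, DR]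
  set m : V ⊗[R] V →ₗ[R] W := TensorProduct.lift B with hm
  have h₁ : IsNilpotent.exp E (B x y) = m (IsNilpotent.exp (DL + DR) (x ⊗ₜ[R] y)) := by
    suffices IsNilpotent.exp E ∘ₗ m = m ∘ₗ IsNilpotent.exp (DL + DR) by
      simpa [hm] using LinearMap.congr_fun this (x ⊗ₜ[R] y)
    apply Module.End.commute_exp_left_of_commute (h_comm.isNilpotent_add h_nilL h_nilR) hE
    ext
    simp [DL, DR, hm, h, add_comm]
  have h₂ : IsNilpotent.exp DL = (IsNilpotent.exp D).lTensor V :=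
    (hD.map_exp (Module.End.lTensorAlgHom R V V)).symm
  have h₃ : IsNilpotent.exp DR = (IsNilpotent.exp D).rTensor V :=
    (hD.map_exp (Module.End.rTensorAlgHom R V V)).symm
  simp [h₁, IsNilpotent.exp_add_of_commute h_comm h_nilL h_nilR, h₂, h₃, hm]

namespace DGLA

variable {K : Type k} [Field K]

/-- The composition of morphisms of differential graded Lie algebras. -/
def Hom.comp {L M N : DGLA.{k, u} K} (ψ : Hom M N) (φ : Hom L M) : Hom L N where
  toLin := ψ.toLin ∘ₗ φ.toLin
  map_deg := fun h => ψ.map_deg (φ.map_deg h)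
  map_d := fun x => by simp [φ.map_d, ψ.map_d]
  map_bracket := fun x y => by simp [φ.map_bracket, ψ.map_bracket]

theorem bracket_sign (L : DGLA.{k, u} K) (x y : L.carrier) :
    L.sign (L.bracket x y) = L.bracket (L.sign x) (L.sign y) := by
  have : L.bracket.compr₂ L.sign = L.bracket.compl₁₂ L.sign L.sign :=
    L.hom_ext fun i x hx => L.hom_ext fun j y hy => by
      simp [L.sign_of_mem hx, L.sign_of_mem hy, L.sign_of_mem (L.bracket_mem hx hy),
        zpow_add₀ (neg_ne_zero.2 (one_ne_zero (α := K))), smul_smul, mul_comm]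
  exact LinearMap.congr_fun₂ this x y

/-- A degree-zero element acts on brackets as a derivation. -/
theorem jacobi_zero (L : DGLA.{k, u} K) {a : L.carrier} (ha : a ∈ L.deg 0) (x y : L.carrier) :
    L.bracket a (L.bracket x y) =
      L.bracket (L.bracket a x) y + L.bracket x (L.bracket a y) := by
  have : L.bracket.compr₂ (L.bracket a) =
      L.bracket ∘ₗ L.bracket a + L.bracket.compl₂ (L.bracket a) :=
    L.hom_ext fun i x hx => by
      ext y
      simp [L.jacobi y ha hx]
  exact LinearMap.congr_fun₂ this x y

/-- The restriction of the bracket of `L ⊕ K d` to pairs, with values in `L`. -/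
def bracketD (L : DGLA.{k, u} K) : (L.carrier × K) →ₗ[K] (L.carrier × K) →ₗ[K] L.carrier :=
  L.bracket.compl₁₂ (LinearMap.fst K _ _) (LinearMap.fst K _ _) +
    ((LinearMap.lsmul K L.carrier).flip ∘ₗ L.d).flip.compl₁₂
      (LinearMap.snd K _ _) (LinearMap.fst K _ _) +
    ((LinearMap.lsmul K L.carrier).flip ∘ₗ L.sign ∘ₗ L.d).compl₁₂
      (LinearMap.fst K _ _) (LinearMap.snd K _ _)

/-- For `x` of degree `i`, skew-symmetry gives `[x, d] = -(-1)^i dx`, which is `L.sign (L.d x)`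
because `dx` has degree `i + 1`. The bracket `[d, d]` is zero. -/
theorem bracketD_apply (L : DGLA.{k, u} K) (x y : L.carrier) (β γ : K) :
    L.bracketD (x, β) (y, γ) = L.bracket x y + β • L.d y + γ • L.sign (L.d x) := by
  simp [bracketD]

/-- This is the Jacobi identity in `L ⊕ K d`: it combines the Jacobi identity of `L` with the
Leibniz rule for `d`. It is the derivation hypothesis needed by `exp_of_derivation`. -/
theorem bracket_bracketD (L : DGLA.{k, u} K) {a : L.carrier} (ha : a ∈ L.deg 0)
    (p q : L.carrier × K) :
    L.bracket a (L.bracketD p q) = L.bracketD (L.adD a p) q + L.bracketD p (L.adD a q) := by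
  obtain ⟨x, β⟩ := p
  obtain ⟨y, γ⟩ := q
  have hda : L.d a ∈ L.deg 1 := by simpa using L.d_mem ha
  have h1 : L.bracket x (L.d a) = L.sign (L.bracket (L.d a) x) := by
    have : L.bracket.flip (L.d a) = L.sign ∘ₗ L.bracket (L.d a) := L.hom_ext fun i x hx => by
      have := L.bracket_skew hx hda
      have h2 := L.bracket_mem hda hx
      simp only [LinearMap.flip_apply, LinearMap.comp_apply, L.sign_of_mem h2]
      rw [eq_neg_of_add_eq_zero_left this, mul_one,
        zpow_add₀ (neg_ne_zero.2 (one_ne_zero (α := K))), zpow_one, neg_one_mul, neg_smul]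
    exact LinearMap.congr_fun this x
  have h2 : L.sign (L.bracket a (L.d x)) = L.bracket a (L.sign (L.d x)) := by
    rw [L.bracket_sign, L.sign_of_mem ha]; simp
  have h3 : ∀ z, L.d (L.bracket a z) = L.bracket (L.d a) z + L.bracket a (L.d z) := by
    intro z
    simpa using L.d_bracket z ha
  simp only [adD_apply, bracketD_apply, map_add, map_sub, map_smul, LinearMap.sub_apply,
    LinearMap.smul_apply, L.d_d, h3, h1, h2, L.jacobi_zero ha, zero_smul, smul_zero]
  simp only [smul_sub, smul_add, smul_zero, map_zero]
  module

theorem fst_adD_pow (L : DGLA.{k, u} K) (a x : L.carrier) (n : ℕ) :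
    ((L.adD a) ^ n) (x, 0) = (((L.bracket a) ^ n) x, 0) := by
  induction n generalizing x with
  | zero => simp
  | succ n ih => rw [pow_succ, pow_succ, Module.End.mul_apply, Module.End.mul_apply, adD_apply,
      zero_smul, sub_zero, ih]

theorem gauge_eq_sum (L : DGLA.{k, u} K) {a : L.carrier} {m : ℕ} (hm : (L.adD a) ^ m = 0)
    (x : L.carrier) :
    L.gauge a x =
      (∑ n ∈ Finset.range m, ((n.factorial : K)⁻¹) • ((L.adD a) ^ n) (x, 1)).1 := by
  rw [gauge, finsum_eq_sum_of_support_subset]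
  intro n hn
  by_contra hmn
  refine hn ?_
  have hmn' : m ≤ n := by simpa using hmn
  simp [pow_eq_zero_of_le hmn' hm]

/-- The terms of positive degree in the exponential series have no component along `d`. -/
theorem adD_pow_succ (L : DGLA.{k, u} K) (a x : L.carrier) (n : ℕ) :
    ((L.adD a) ^ (n + 1)) (x, 1) = (((L.bracket a) ^ n) (L.bracket a x - L.d a), 0) := by
  rw [pow_succ, Module.End.mul_apply, adD_apply, one_smul, fst_adD_pow]

/-- The gauge action in closed form. -/
theorem gauge_eq (L : DGLA.{k, u} K) {a : L.carrier} {m : ℕ} (hm : (L.adD a) ^ (m + 1) = 0)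
    (x : L.carrier) :
    L.gauge a x = x + ∑ n ∈ Finset.range m,
      (((n + 1).factorial : K)⁻¹) • ((L.bracket a) ^ n) (L.bracket a x - L.d a) := by
  rw [L.gauge_eq_sum hm, Finset.sum_range_succ']
  simp only [adD_pow_succ, Prod.fst_add, Prod.fst_sum, Prod.smul_fst]
  simp [add_comm]

theorem bracket_pow_mem (L : DGLA.{k, u} K) {a : L.carrier} (ha : a ∈ L.deg 0) {i : ℤ}
    {x : L.carrier} (hx : x ∈ L.deg i) (n : ℕ) : ((L.bracket a) ^ n) x ∈ L.deg i := by
  induction n with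
  | zero => simpa
  | succ n ih =>
    rw [pow_succ', Module.End.mul_apply]
    simpa using L.bracket_mem ha ih

/-- The gauge action preserves the set of Maurer–Cartan elements. -/
theorem gauge_mem_MC [CharZero K] (L : DGLA.{k, u} K) {a : L.carrier} (ha : a ∈ L.deg 0)
    (hn : IsNilpotent (L.adD a)) {x : L.carrier} (hx : x ∈ L.MC) : L.gauge a x ∈ L.MC := by
  obtain ⟨m, hm⟩ := hn
  have hm1 : (L.adD a) ^ (m + 1) = 0 := pow_eq_zero_of_le (Nat.le_succ m) hm
  have hdeg : L.gauge a x ∈ L.deg 1 := by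
    rw [L.gauge_eq hm1]
    refine add_mem hx.1 (Submodule.sum_mem _ fun n _ => Submodule.smul_mem _ _
      (L.bracket_pow_mem ha (sub_mem ?_ ?_) n))
    · simpa using L.bracket_mem ha hx.1
    · simpa using L.d_mem ha
  refine ⟨hdeg, ?_⟩
  -- The Maurer–Cartan equation for `y` says that `y + d` has square zero, a condition preserved by
  -- the exponential of a derivation.
  have h2 : ∀ y ∈ L.deg 1, L.bracketD (y, 1) (y, 1) =
      (2 : K) • (L.d y + (2 : K)⁻¹ • L.bracket y y) := by
    intro y hy
    have : L.d y ∈ L.deg 2 := by simpa using L.d_mem hy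
    rw [bracketD_apply, L.sign_of_mem this]
    simp only [one_smul, smul_add, smul_smul, even_two.neg_one_zpow,
      mul_inv_cancel₀ (two_ne_zero (α := K)), two_smul]
    abel
  -- `IsNilpotent.exp` has rational coefficients, whereas the gauge series has coefficients in `K`;
  -- this structure makes the two comparable.
  let _ : Module ℚ L.carrier := Module.compHom L.carrier (algebraMap ℚ K)
  have hE : (L.bracket a) ^ m = 0 := by
    ext y
    have := L.fst_adD_pow a y m
    rw [hm] at this
    simpa using (congrArg Prod.fst this).symm
  have hexp : IsNilpotent.exp (L.adD a) (x, 1) = (L.gauge a x, 1) := by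
    have key : ∀ (q : ℚ) (p : L.carrier × K), q • p = (algebraMap ℚ K q) • p := fun q p =>
      Prod.ext rfl (Algebra.smul_def q p.2)
    rw [IsNilpotent.exp_eq_sum hm1, LinearMap.sum_apply]
    simp only [LinearMap.smul_apply, key]
    simp only [map_inv₀, map_natCast]
    refine Prod.ext (L.gauge_eq_sum hm1 x).symm ?_
    rw [Finset.sum_range_succ']
    simp only [adD_pow_succ, Prod.snd_add, Prod.snd_sum, Prod.smul_snd]
    simp
  have key := exp_of_derivation L.bracketD (L.adD a) (L.bracket a) (L.bracket_bracketD ha)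
    ⟨m, hm⟩ ⟨m, hE⟩ (x, 1) (x, 1)
  rw [hexp, h2 x hx.1, hx.2, smul_zero, map_zero, h2 _ hdeg] at key
  exact (smul_eq_zero.1 key.symm).resolve_left two_ne_zero

end DGLA

/-! ### Contractible kernels and their tensor products. -/

namespace DGModule

variable {K : Type k} [Field K]

/-- A contraction of the kernel of a morphism of complexes `p`: an endomorphism `σ` of degree `-1`
with values in the kernel, such that `dσ + σd` is the identity on the kernel. -/
structure Hom.IsKernelContraction {V : DGModule.{k, u} K} {W : DGModule.{k, v} K} (p : Hom V W)
    (σ : V.carrier →ₗ[K] V.carrier) : Prop where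
  map_deg : ∀ {i : ℤ} {x : V.carrier}, x ∈ V.deg i → σ x ∈ V.deg (i - 1)
  map_eq_zero : ∀ x, p.toLin (σ x) = 0
  homotopy : ∀ x, p.toLin x = 0 → V.d (σ x) + σ (V.d x) = x

/-- A morphism of complexes is a trivial fibration if it is surjective and its kernel is
contractible. -/
def Hom.IsTrivialFibration {V : DGModule.{k, u} K} {W : DGModule.{k, v} K} (p : Hom V W) : Prop :=
  Function.Surjective p.toLin ∧ ∃ σ, p.IsKernelContraction σ

theorem rTensor_mem_tensorDeg {V : DGModule.{k, u} K} {W : DGModule.{k, w} K}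
    {σ : V.carrier →ₗ[K] V.carrier}
    (h : ∀ {i : ℤ} {x : V.carrier}, x ∈ V.deg i → σ x ∈ V.deg (i - 1)) {n : ℤ}
    {t : V.carrier ⊗[K] W.carrier} (ht : t ∈ tensorDeg V W n) :
    σ.rTensor W.carrier t ∈ tensorDeg V W (n - 1) := by
  induction ht using Submodule.span_induction with
  | mem t ht =>
    obtain ⟨i, j, rfl, x, hx, y, hy, rfl⟩ := ht
    exact tmul_mem_tensorDeg V W (by ring) (h hx) hy
  | zero => simp
  | add x y _ _ hx hy => rw [map_add]; exact add_mem hx hy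
  | smul a x _ hx => rw [map_smul]; exact Submodule.smul_mem _ _ hx

/-- Tensoring a contraction of a kernel with a complex gives a contraction of the kernel. -/
theorem Hom.IsKernelContraction.rTensor {V V' : DGModule.{k, u} K} {p : Hom V V'}
    {σ : V.carrier →ₗ[K] V.carrier} (h : p.IsKernelContraction σ)
    (hp : Function.Surjective p.toLin) {W : DGModule.{k, w} K} (g : Hom W W)
    (hg : g.toLin = LinearMap.id) :
    (p.tensor g).IsKernelContraction (σ.rTensor W.carrier : _ →ₗ[K] _) where
  map_deg := rTensor_mem_tensorDeg h.map_deg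
  map_eq_zero := by
    intro t
    have : TensorProduct.map p.toLin g.toLin ∘ₗ σ.rTensor W.carrier = 0 := by
      ext x y
      simp [h.map_eq_zero]
    exact LinearMap.congr_fun this t
  homotopy := by
    intro t ht
    -- Since `σ` has odd degree, the two terms containing the differential of `W` cancel.
    have e : tensorD V W ∘ₗ σ.rTensor W.carrier + σ.rTensor W.carrier ∘ₗ tensorD V W =
        (V.d ∘ₗ σ + σ ∘ₗ V.d).rTensor W.carrier := by
      apply TensorProduct.ext
      refine V.hom_ext fun i x hx => ?_
      ext y
      have hi : (-1 : K) ^ (i - 1) = -(-1) ^ i := by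
        rw [zpow_sub₀ (neg_ne_zero.2 (one_ne_zero (α := K)))]; simp [div_neg]
      simp [tensorD_tmul V W hx, tensorD_tmul V W (h.map_deg hx), hi]
      abel
    refine (LinearMap.congr_fun e t).trans ?_
    have ht' : p.toLin.rTensor W.carrier t = 0 := by
      rw [LinearMap.rTensor, ← hg]; exact ht
    -- By right exactness the kernel of `p ⊗ 1` is the image of `ker p ⊗ W`, where the homotopy
    -- identity of `σ` applies.
    obtain ⟨s, rfl⟩ := (rTensor_exact W.carrier
      (LinearMap.exact_subtype_ker_map p.toLin) hp t).1 ht'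
    rw [← LinearMap.comp_apply, ← LinearMap.rTensor_comp]
    congr 2
    ext ⟨x, hx⟩
    exact h.homotopy x hx

end DGModule

/-! ### Maurer–Cartan elements along trivial fibrations. -/

namespace DGLA

variable {K : Type k} [Field K]

/-- A finite decreasing filtration of a differential graded Lie algebra whose steps are raised by
the bracket. -/
structure NilpotentFiltration (L : DGLA.{k, u} K) where
  toFun : ℕ → Submodule K L.carrier
  zero : toFun 0 = ⊤
  succ_le : ∀ n, toFun (n + 1) ≤ toFun n
  bracket_mem : ∀ {n : ℕ} (s : L.carrier) {t : L.carrier}, t ∈ toFun n →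
    L.bracket s t ∈ toFun (n + 1)
  eq_bot : ∃ n, toFun n = ⊥

/-- The axiom concerns the second argument only. Skew-symmetry transfers it to the first, at the
price of homogeneity. -/
theorem NilpotentFiltration.bracket_mem' {L : DGLA.{k, u} K} (F : L.NilpotentFiltration) {n : ℕ}
    {i j : ℤ} {s t : L.carrier} (hsi : s ∈ L.deg i) (hs : s ∈ F.toFun n) (ht : t ∈ L.deg j) :
    L.bracket s t ∈ F.toFun (n + 1) := by
  rw [eq_neg_of_add_eq_zero_left (L.bracket_skew hsi ht)]
  exact neg_mem (Submodule.smul_mem _ _ (F.bracket_mem t hs))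

/-- The left-hand side `dx + ½[x, x]` of the Maurer–Cartan equation. -/
def curvature (L : DGLA.{k, u} K) (x : L.carrier) : L.carrier :=
  L.d x + (2 : K)⁻¹ • L.bracket x x

theorem Hom.map_curvature {L N : DGLA.{k, u} K} (φ : Hom L N) (x : L.carrier) :
    φ.toLin (L.curvature x) = N.curvature (φ.toLin x) := by
  simp [curvature, φ.map_d, φ.map_bracket]

theorem bracket_comm_of_deg_one (L : DGLA.{k, u} K) {x y : L.carrier} (hx : x ∈ L.deg 1)
    (hy : y ∈ L.deg 1) : L.bracket x y = L.bracket y x := by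
  rw [eq_neg_of_add_eq_zero_left (L.bracket_skew hx hy)]; simp

theorem curvature_mem (L : DGLA.{k, u} K) {x : L.carrier} (hx : x ∈ L.deg 1) :
    L.curvature x ∈ L.deg 2 :=
  add_mem (by simpa using L.d_mem hx)
    (Submodule.smul_mem _ _ (by simpa using L.bracket_mem hx hx))

/-- The bracket is symmetric in degree one, so the two mixed halves add up to `[x, y]`. -/
theorem curvature_add [CharZero K] (L : DGLA.{k, u} K) {x y : L.carrier} (hx : x ∈ L.deg 1)
    (hy : y ∈ L.deg 1) :
    L.curvature (x + y) =
      L.curvature x + L.d y + L.bracket x y + (2 : K)⁻¹ • L.bracket y y := by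
  simp only [curvature, map_add, LinearMap.add_apply, L.bracket_comm_of_deg_one hy hx]
  have : L.bracket x y = (2 : K)⁻¹ • L.bracket x y + (2 : K)⁻¹ • L.bracket x y := by
    rw [← add_smul, ← two_mul, mul_inv_cancel₀ (two_ne_zero (α := K)), one_smul]
  nth_rw 3 [this]
  simp only [smul_add]
  abel

/-- The Bianchi identity. -/
theorem d_curvature [CharZero K] (L : DGLA.{k, u} K) {x : L.carrier} (hx : x ∈ L.deg 1) :
    L.d (L.curvature x) = -L.bracket x (L.curvature x) := by
  have hdx : L.d x ∈ L.deg 2 := by simpa using L.d_mem hx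
  have hxx : L.bracket x x ∈ L.deg 2 := by simpa using L.bracket_mem hx hx
  have hskew : ∀ y ∈ L.deg 2, L.bracket y x = -L.bracket x y := fun y hy => by
    rw [eq_neg_of_add_eq_zero_left (L.bracket_skew hy hx)]; simp
  -- Jacobi and skew-symmetry give `[x, [x, x]] = -2 [x, [x, x]]`, so three times this bracket
  -- vanishes.
  have hjac : L.bracket x (L.bracket x x) = 0 := by
    have h := L.jacobi x hx hx
    rw [hskew _ hxx] at h
    simp only [mul_one, zpow_one, neg_smul, one_smul] at h
    have h3 : (3 : K) • L.bracket x (L.bracket x x) = 0 := by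
      linear_combination (norm := module) h
    exact (smul_eq_zero.1 h3).resolve_left three_ne_zero
  simp only [curvature, map_add, map_smul, L.d_d, L.d_bracket x hx, hskew _ hdx, hjac, zpow_one,
    neg_smul, one_smul, smul_zero, add_zero, zero_add]
  have : (2 : K)⁻¹ + (2 : K)⁻¹ = 1 := by
    rw [← two_mul, mul_inv_cancel₀ (two_ne_zero (α := K))]
  rw [← neg_add, smul_neg, smul_add, ← add_smul, this, one_smul]

section Lifting

variable {L P : DGLA.{k, u} K} {p : Hom L P} {σ : L.carrier →ₗ[K] L.carrier}

/-- Maurer–Cartan elements lift along trivial fibrations. -/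
theorem Hom.exists_MC_lift [CharZero K] (F : L.NilpotentFiltration)
    (hp : Function.Surjective p.toLin) (hσ : p.toHom.IsKernelContraction σ)
    (hσF : ∀ {n x}, x ∈ F.toFun n → σ x ∈ F.toFun n) {y : P.carrier} (hy : y ∈ P.MC) :
    ∃ x ∈ L.MC, p.toLin x = y := by
  -- Any lift of degree one starts the induction; at the step where the filtration vanishes, the
  -- curvature is zero.
  have key : ∀ n, ∃ x ∈ L.deg 1, p.toLin x = y ∧ L.curvature x ∈ F.toFun n := by
    intro n
    induction n with
    | zero =>
      obtain ⟨x, hx, hxy⟩ := p.toHom.exists_lift hp hy.1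
      exact ⟨x, hx, hxy, by rw [F.zero]; trivial⟩
    | succ n ih =>
      obtain ⟨x, hx, hxy, hn⟩ := ih
      have hk : L.curvature x ∈ LinearMap.ker p.toLin := by
        rw [LinearMap.mem_ker, p.map_curvature, hxy]; exact hy.2
      have h2 := L.curvature_mem hx
      have hs : -σ (L.curvature x) ∈ L.deg 1 := neg_mem (by simpa using hσ.map_deg h2)
      have hsn : -σ (L.curvature x) ∈ F.toFun n := neg_mem (hσF hn)
      -- With `c` the curvature of `x`, which lies in the kernel, the new curvature is `c - dσ(c) =
      -- σ(dc)` modulo the next step. By Bianchi `σ(dc) = -σ[x, c]`, which also lies in the next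
      -- step.
      refine ⟨x + -σ (L.curvature x), add_mem hx hs, by
        rw [map_add, map_neg, hσ.map_eq_zero, neg_zero, add_zero, hxy], ?_⟩
      rw [L.curvature_add hx hs]
      refine add_mem (add_mem ?_ (F.bracket_mem x hsn))
        (Submodule.smul_mem _ _ (F.bracket_mem _ hsn))
      have h1 := hσ.homotopy _ hk
      rw [L.d_curvature hx, map_neg] at h1
      have h3 : L.curvature x + L.d (-σ (L.curvature x)) =
          -σ (L.bracket x (L.curvature x)) := by
        rw [map_neg]
        nth_rw 1 [← h1]
        abel
      rw [h3]
      exact neg_mem (hσF (F.bracket_mem x hn))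
  obtain ⟨m, hm⟩ := F.eq_bot
  obtain ⟨x, hx, hxy, hc⟩ := key m
  rw [hm, Submodule.mem_bot] at hc
  exact ⟨x, ⟨hx, hc⟩, hxy⟩

theorem gauge_zero (L : DGLA.{k, u} K) (x : L.carrier) : L.gauge 0 x = x := by
  have h : L.adD 0 = 0 := by
    ext <;> simp [adD]
  rw [L.gauge_eq (m := 0) (by simp [h])]
  simp

/-- Maurer–Cartan elements with the same image under a trivial fibration are gauge equivalent. -/
theorem Hom.gauge_equiv_of_map_eq [CharZero K] (F : L.NilpotentFiltration)
    (hnil : ∀ a, IsNilpotent (L.adD a)) (hσ : p.toHom.IsKernelContraction σ)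
    (hσF : ∀ {n x}, x ∈ F.toFun n → σ x ∈ F.toFun n) (x y : L.MC)
    (hxy : p.toLin (x : L.carrier) = p.toLin (y : L.carrier)) :
    Quot.mk (GaugeRel L) x = Quot.mk (GaugeRel L) y := by
  -- Recording the class of `z` in the quotient, rather than a single gauge parameter, makes it
  -- unnecessary to compose gauge transformations.
  have key : ∀ n, ∃ z : L.MC, Quot.mk (GaugeRel L) z = Quot.mk (GaugeRel L) y ∧
      p.toLin (z : L.carrier) = p.toLin (x : L.carrier) ∧ (z - x : L.carrier) ∈ F.toFun n := by
    intro n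
    induction n with
    | zero => exact ⟨y, rfl, hxy.symm, by rw [F.zero]; trivial⟩
    | succ n ih =>
      obtain ⟨z, hzy, hzx, hn⟩ := ih
      set j : L.carrier := z - x with hj
      have hj1 : j ∈ L.deg 1 := sub_mem z.2.1 x.2.1
      have hpj : p.toLin j = 0 := by rw [hj, map_sub, hzx, sub_self]
      -- Subtracting the Maurer–Cartan equations of `z` and `x` expresses `dj` through brackets with
      -- `j`.
      have hdj : L.d j ∈ F.toFun (n + 1) := by
        have h := L.curvature_add x.2.1 hj1
        have hx0 : L.curvature x = 0 := x.2.2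
        have hz0 : L.curvature z = 0 := z.2.2
        rw [hj, add_sub_cancel, ← hj, hx0, hz0, zero_add] at h
        have h' : L.d j = -(L.bracket x j + (2 : K)⁻¹ • L.bracket j j) := by
          rw [eq_neg_iff_add_eq_zero, ← add_assoc, ← h]
        rw [h']
        exact neg_mem (add_mem (F.bracket_mem _ hn)
          (Submodule.smul_mem _ _ (F.bracket_mem _ hn)))
      have ha0 : σ j ∈ L.deg 0 := by simpa using hσ.map_deg hj1
      have hda : L.d (σ j) ∈ L.deg 1 := by simpa using L.d_mem ha0
      have hbr : ∀ v ∈ L.deg 1, L.bracket (σ j) v ∈ F.toFun (n + 1) := fun v hv =>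
        F.bracket_mem' ha0 (hσF hn) hv
      obtain ⟨m, hm⟩ := hnil (σ j)
      -- Modulo brackets with `σ j`, which lie in the next step, `e^(σ j) z - x` is `j - dσ(j) =
      -- σ(dj)`. The image under `p` does not move because `p ∘ σ = 0`.
      refine ⟨⟨L.gauge (σ j) z, L.gauge_mem_MC ha0 ⟨m, hm⟩ z.2⟩, ?_, ?_, ?_⟩
      · rw [← hzy]
        exact (Quot.sound ⟨σ j, ha0, rfl⟩).symm
      · rw [p.map_gauge ⟨m, hm⟩, hσ.map_eq_zero, gauge_zero, hzx]
      · have hu : L.bracket (σ j) z - L.d (σ j) ∈ L.deg 1 :=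
          sub_mem (by simpa using L.bracket_mem ha0 z.2.1) hda
        -- The larger exponent keeps the sum in `gauge_eq` nonempty, so that its leading term can be
        -- split off.
        have hm2 : (L.adD (σ j)) ^ (m + 1 + 1) = 0 := pow_eq_zero_of_le (by omega) hm
        show L.gauge (σ j) z - x ∈ _
        rw [L.gauge_eq hm2, Finset.sum_range_succ']
        have h1 := hσ.homotopy j hpj
        have e : ∀ S : L.carrier, (z : L.carrier) + (S + (((0 + 1).factorial : K)⁻¹) •
            ((L.bracket (σ j)) ^ 0) (L.bracket (σ j) z - L.d (σ j))) - x =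
            S + L.bracket (σ j) z + σ (L.d j) := fun S => by
          have h2 : σ (L.d j) = z - x - L.d (σ j) := eq_sub_of_add_eq' h1
          rw [h2]
          simp
          abel
        rw [e]
        refine add_mem (add_mem (Submodule.sum_mem _ fun i _ => Submodule.smul_mem _ _ ?_)
          (hbr _ z.2.1)) (hσF hdj)
        rw [pow_succ', Module.End.mul_apply]
        exact hbr _ (L.bracket_pow_mem ha0 hu i)
  obtain ⟨m, hm⟩ := F.eq_bot
  obtain ⟨z, hzy, -, hz⟩ := key m
  rw [hm, Submodule.mem_bot, sub_eq_zero] at hz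
  rw [← hzy, Subtype.ext hz]

end Lifting

/-! ### Deformations along trivial fibrations. -/

theorem algPow_succ_le {A : Type u} [AddCommGroup A] [Module K A] (m : A →ₗ[K] A →ₗ[K] A)
    (n : ℕ) : algPow m (n + 1) ≤ algPow m n := by
  induction n with
  | zero => exact le_top
  | succ n ih => exact Submodule.map₂_le_map₂_right ih

/-- The filtration of `L ⊗ A` by the subspaces `L ⊗ Aⁿ`. -/
def tensorFiltration (L : DGLA.{k, u} K) (A : NilpDGA.{k, w} K) :
    (L.tensor A).NilpotentFiltration where
  toFun := tensorPow L A
  zero := TensorProduct.map₂_mk_top_top_eq_top K _ _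
  succ_le n := Submodule.map₂_le_map₂_right (algPow_succ_le A.mul n)
  bracket_mem := tensorBracket_mem_tensorPow L A
  eq_bot := by
    obtain ⟨m, hm⟩ := A.nilpotent
    exact ⟨m, by rw [tensorPow, hm]; exact Submodule.map₂_bot_right _ _⟩

theorem rTensor_mem_tensorPow {L : DGLA.{k, u} K} {A : NilpDGA.{k, w} K}
    (σ : L.carrier →ₗ[K] L.carrier) {n : ℕ} {t : L.carrier ⊗[K] A.carrier}
    (ht : t ∈ tensorPow L A n) : σ.rTensor A.carrier t ∈ tensorPow L A n := by
  have : tensorPow L A n ≤ (tensorPow L A n).comap (σ.rTensor A.carrier) :=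
    Submodule.map₂_le.2 fun y _ b hb => Submodule.apply_mem_map₂ _ Submodule.mem_top hb
  exact this ht

/-- A trivial fibration induces a bijection on deformations. -/
theorem DefSet.map_bijective_of_isTrivialFibration [CharZero K] {L P : DGLA.{k, u} K}
    (p : Hom L P) (hp : p.toHom.IsTrivialFibration) (A : NilpDGA.{k, w} K) :
    Function.Bijective (DefSet.map p (𝟙 A)) := by
  obtain ⟨hs, σ, hσ⟩ := hp
  have hσ' : (p.tensor (𝟙 A)).toHom.IsKernelContraction (σ.rTensor A.carrier) :=
    hσ.rTensor hs _ rfl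
  have hs' : Function.Surjective (p.tensor (𝟙 A)).toLin :=
    TensorProduct.map_surjective hs Function.surjective_id
  have hlift : ∀ y : (P.tensor A).MC, ∃ x : (L.tensor A).MC,
      (p.tensor (𝟙 A)).toLin (x : (L.tensor A).carrier) = y := fun y => by
    obtain ⟨x, hx, hxy⟩ := Hom.exists_MC_lift (tensorFiltration L A) hs' hσ'
      (rTensor_mem_tensorPow σ) y.2
    exact ⟨⟨x, hx⟩, hxy⟩
  have hfib := Hom.gauge_equiv_of_map_eq (p := p.tensor (𝟙 A)) (tensorFiltration L A)
    (isNilpotent_adD L A) hσ' (rTensor_mem_tensorPow σ)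
  choose lift hl using hlift
  -- Arbitrary lifts define the inverse. If `z = e^a y` and `b` lifts `a`, then `e^b` applied to the
  -- lift of `y` has the same image as the lift of `z`, so `hfib` identifies their classes.
  let inv : DefSet P A → DefSet L A := Quot.lift (fun y => Quot.mk _ (lift y)) (by
    rintro y z ⟨a, ha, hz⟩
    obtain ⟨b, hb, rfl⟩ := (p.tensor (𝟙 A)).toHom.exists_lift hs' ha
    have hn := isNilpotent_adD L A b
    have h1 : Quot.mk (GaugeRel (L.tensor A)) (lift y) = Quot.mk _
        ⟨(L.tensor A).gauge b (lift y), (L.tensor A).gauge_mem_MC hb hn (lift y).2⟩ :=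
      Quot.sound ⟨b, hb, rfl⟩
    refine h1.trans (hfib _ _ ?_)
    rw [(p.tensor (𝟙 A)).map_gauge hn, hl, hl, hz])
  refine Function.bijective_iff_has_inverse.2 ⟨inv, fun x => ?_, fun y => ?_⟩
  · induction x using Quot.ind with | mk x =>
    exact hfib _ _ (hl _)
  · induction y using Quot.ind with | mk y =>
    exact congrArg (Quot.mk _) (Subtype.ext (hl y))

end DGLA

/-! ### Polynomials, forms on the line and fibre products of complexes. -/

namespace DGModule

variable {K : Type k} [Field K]

/-- The polynomials whose coefficients have degree `i`. -/
def polyDeg (V : DGModule.{k, u} K) (i : ℤ) : Submodule K (ℕ →₀ V.carrier) where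
  carrier := {f | ∀ p, f p ∈ V.deg i}
  zero_mem' := fun _ => zero_mem _
  add_mem' := fun hf hg p => add_mem (hf p) (hg p)
  smul_mem' := fun c _ hf p => Submodule.smul_mem _ c (hf p)

theorem single_mem_polyDeg (V : DGModule.{k, u} K) {i : ℤ} {x : V.carrier} (hx : x ∈ V.deg i)
    (p : ℕ) : Finsupp.single p x ∈ V.polyDeg i := by
  intro q
  rw [Finsupp.single_apply]
  split_ifs
  · exact hx
  · exact zero_mem _

theorem polyDeg_le (V : DGModule.{k, u} K) {i : ℤ} {S : Submodule K (ℕ →₀ V.carrier)}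
    (h : ∀ p, ∀ x ∈ V.deg i, Finsupp.single p x ∈ S) : V.polyDeg i ≤ S := by
  intro f hf
  rw [← f.sum_single]
  exact Submodule.sum_mem _ fun p _ => h p _ (hf p)

theorem eqOn_polyDeg (V : DGModule.{k, u} K) {M : Type v} [AddCommGroup M] [Module K M] {i : ℤ}
    {f g : (ℕ →₀ V.carrier) →ₗ[K] M}
    (h : ∀ p, ∀ x ∈ V.deg i, f (Finsupp.single p x) = g (Finsupp.single p x))
    {t : ℕ →₀ V.carrier} (ht : t ∈ V.polyDeg i) : f t = g t :=
  V.polyDeg_le (S := LinearMap.eqLocus f g) h ht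

/-- The complex `V[t]` of polynomials with coefficients in `V`. -/
@[reducible]
def poly (V : DGModule.{k, u} K) : DGModule.{k, u} K where
  carrier := ℕ →₀ V.carrier
  deg := V.polyDeg
  isInternal := by
    refine isInternal_of_proj _ (fun i => Finsupp.mapRange.linearMap (V.proj i)) ?_ ?_ ?_
    · intro i f hf
      ext p
      simp [V.proj_of_mem (hf p)]
    · intro i j hij f hf
      ext p
      simp [V.proj_of_mem_ne hij (hf p)]
    · intro f
      rw [← f.sum_single]
      refine Submodule.sum_mem _ fun p _ => ?_
      have h : ⨆ i, V.deg i ≤ (⨆ i, V.polyDeg i).comap (Finsupp.lsingle p) :=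
        iSup_le fun i x hx => Submodule.mem_iSup_of_mem i (V.single_mem_polyDeg hx p)
      exact h (V.mem_iSup_deg _)
  d := Finsupp.mapRange.linearMap V.d
  d_mem := fun hf p => V.d_mem (hf p)
  d_d := fun f => by ext p; simp [V.d_d]

/-- A morphism from `V[t]` is determined by its values on monomials. -/
def polyHom (V : DGModule.{k, u} K) {W : DGModule.{k, v} K}
    (A : (ℕ →₀ V.carrier) →ₗ[K] W.carrier)
    (hdeg : ∀ {i : ℤ} (p : ℕ), ∀ x ∈ V.deg i, A (Finsupp.single p x) ∈ W.deg i)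
    (hd : ∀ p x, A (Finsupp.single p (V.d x)) = W.d (A (Finsupp.single p x))) :
    Hom V.poly W where
  toLin := A
  map_deg := fun {i} _ hf => V.polyDeg_le (S := (W.deg i).comap A) hdeg hf
  map_d := fun f => LinearMap.congr_fun (f := A ∘ₗ V.poly.d) (g := W.d ∘ₗ A)
    (Finsupp.lhom_ext fun p x => by simp [hd]) f

theorem poly_sign_single (V : DGModule.{k, u} K) (p : ℕ) (x : V.carrier) :
    V.poly.sign (Finsupp.single p x) = Finsupp.single p (V.sign x) := by
  have : V.poly.sign ∘ₗ Finsupp.lsingle p = Finsupp.lsingle p ∘ₗ V.sign :=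
    V.hom_ext fun i x hx => by
      simp [V.sign_of_mem hx, V.poly.sign_of_mem (V.single_mem_polyDeg hx p)]
  exact LinearMap.congr_fun this x

/-- The derivative with respect to `t`. -/
def polyDeriv (V : DGModule.{k, u} K) : (ℕ →₀ V.carrier) →ₗ[K] (ℕ →₀ V.carrier) :=
  -- For `p = 0` the truncated exponent is harmless, since the coefficient vanishes.
  Finsupp.lsum K fun p => (p : K) • Finsupp.lsingle (p - 1)

@[simp]
theorem polyDeriv_single (V : DGModule.{k, u} K) (p : ℕ) (x : V.carrier) :
    V.polyDeriv (Finsupp.single p x) = Finsupp.single (p - 1) ((p : K) • x) := by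
  simp [polyDeriv]

/-- The primitive with respect to `t` vanishing at `t = 0`. -/
def polyInt (V : DGModule.{k, u} K) : (ℕ →₀ V.carrier) →ₗ[K] (ℕ →₀ V.carrier) :=
  Finsupp.lsum K fun p => ((p : K) + 1)⁻¹ • Finsupp.lsingle (p + 1)

@[simp]
theorem polyInt_single (V : DGModule.{k, u} K) (p : ℕ) (x : V.carrier) :
    V.polyInt (Finsupp.single p x) = Finsupp.single (p + 1) (((p : K) + 1)⁻¹ • x) := by
  simp [polyInt]

/-- The evaluation at `t = c`. -/
def polyEval (V : DGModule.{k, u} K) (c : K) : (ℕ →₀ V.carrier) →ₗ[K] V.carrier :=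
  Finsupp.lsum K fun p => c ^ p • LinearMap.id

@[simp]
theorem polyEval_single (V : DGModule.{k, u} K) (c : K) (p : ℕ) (x : V.carrier) :
    V.polyEval c (Finsupp.single p x) = c ^ p • x := by
  simp [polyEval]

/-- The derivative with respect to `t` as a morphism of complexes. -/
def polyDerivHom (V : DGModule.{k, u} K) : Hom V.poly V.poly :=
  V.polyHom V.polyDeriv
    (fun p x hx => by
      simpa using V.single_mem_polyDeg (Submodule.smul_mem _ (p : K) hx) (p - 1))
    (fun p x => by simp)

/-- The primitive with respect to `t` as a morphism of complexes. -/
def polyIntHom (V : DGModule.{k, u} K) : Hom V.poly V.poly :=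
  V.polyHom V.polyInt
    (fun p x hx => by
      simpa using V.single_mem_polyDeg (Submodule.smul_mem _ ((p : K) + 1)⁻¹ hx) (p + 1))
    (fun p x => by simp)

/-- The evaluation at `t = c` as a morphism of complexes. -/
def polyEvalHom (V : DGModule.{k, u} K) (c : K) : Hom V.poly V :=
  V.polyHom (V.polyEval c)
    (fun p x hx => by simpa using Submodule.smul_mem _ (c ^ p) hx)
    (fun p x => by simp)

theorem polyDeriv_polyInt [CharZero K] (V : DGModule.{k, u} K) (f : ℕ →₀ V.carrier) :
    V.polyDeriv (V.polyInt f) = f :=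
  LinearMap.congr_fun (f := V.polyDeriv ∘ₗ V.polyInt) (g := LinearMap.id)
    (Finsupp.lhom_ext fun p x => by
      have : ((p : K) + 1) ≠ 0 := by exact_mod_cast p.succ_ne_zero
      simp [smul_smul, this]) f

/-- The fundamental theorem of calculus, checked on monomials; only the constant term is lost. -/
theorem polyInt_polyDeriv [CharZero K] (V : DGModule.{k, u} K) (f : ℕ →₀ V.carrier) :
    V.polyInt (V.polyDeriv f) = f - Finsupp.single 0 (V.polyEval 0 f) :=
  LinearMap.congr_fun (f := V.polyInt ∘ₗ V.polyDeriv)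
    (g := LinearMap.id - Finsupp.lsingle 0 ∘ₗ V.polyEval 0)
    (Finsupp.lhom_ext fun p x => by
      rcases p with _ | p
      · simp
      · have : ((p : K) + 1) ≠ 0 := by exact_mod_cast p.succ_ne_zero
        simp [smul_smul, this]) f

theorem polyEval_zero_polyInt (V : DGModule.{k, u} K) (f : ℕ →₀ V.carrier) :
    V.polyEval 0 (V.polyInt f) = 0 :=
  LinearMap.congr_fun (f := V.polyEval 0 ∘ₗ V.polyInt) (g := 0)
    (Finsupp.lhom_ext fun p x => by simp) f

/-- The complex `V ⊗ K[dt]`, with differential twisted by an endomorphism `δ` of `V`: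
the pair `(x, y)` stands for `x + y dt`, and `dx` has the additional component `± δ(x) dt`. -/
@[reducible]
def extendForm (V : DGModule.{k, u} K) (δ : Hom V V) : DGModule.{k, u} K where
  carrier := V.carrier × V.carrier
  deg i := (V.deg i).prod (V.deg (i - 1))
  isInternal := by
    refine isInternal_of_proj _ (fun i => (V.proj i).prodMap (V.proj (i - 1))) ?_ ?_ ?_
    · rintro i ⟨x, y⟩ ⟨hx, hy⟩
      exact Prod.ext (V.proj_of_mem hx) (V.proj_of_mem hy)
    · rintro i j hij ⟨x, y⟩ ⟨hx, hy⟩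
      exact Prod.ext (V.proj_of_mem_ne hij hx) (V.proj_of_mem_ne (by simpa using hij) hy)
    · rintro ⟨x, y⟩
      have h1 : ⨆ i, V.deg i ≤ (⨆ i, (V.deg i).prod (V.deg (i - 1))).comap
          (LinearMap.inl K V.carrier V.carrier) :=
        iSup_le fun i x hx => Submodule.mem_iSup_of_mem i ⟨hx, zero_mem _⟩
      have h2 : ⨆ i, V.deg i ≤ (⨆ i, (V.deg i).prod (V.deg (i - 1))).comap
          (LinearMap.inr K V.carrier V.carrier) :=
        iSup_le fun i x hx => Submodule.mem_iSup_of_mem (i + 1) ⟨zero_mem _, by simpa using hx⟩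
      have h : (x, 0) + (0, y) ∈ ⨆ i, (V.deg i).prod (V.deg (i - 1)) :=
        add_mem (h1 (V.mem_iSup_deg x)) (h2 (V.mem_iSup_deg y))
      simpa using h
  -- With `dt` written on the right, differentiating the coefficient in `t` contributes `(-1)^i δ(x)
  -- dt` for `x` of degree `i`, whence `V.sign`. The square is zero because `V.sign` anticommutes
  -- with `d`.
  d := (V.d ∘ₗ LinearMap.fst K _ _).prod
    (V.d ∘ₗ LinearMap.snd K _ _ + V.sign ∘ₗ δ.toLin ∘ₗ LinearMap.fst K _ _)
  d_mem := by
    rintro i ⟨x, y⟩ ⟨hx, hy⟩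
    refine ⟨V.d_mem hx, add_mem ?_ ?_⟩
    · simpa using V.d_mem hy
    · simpa using V.sign_mem (δ.map_deg hx)
  d_d := by
    rintro ⟨x, y⟩
    simp [V.d_d, V.d_sign, δ.map_d]

/-- The fibre product of complexes. -/
@[reducible]
def fiberProduct {V W X : DGModule.{k, u} K} (f : Hom V X) (g : Hom W X) :
    DGModule.{k, u} K where
  carrier := LinearMap.eqLocus (f.toLin ∘ₗ LinearMap.fst K _ _) (g.toLin ∘ₗ LinearMap.snd K _ _)
  deg i := ((V.deg i).prod (W.deg i)).comap (Submodule.subtype _)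
  isInternal := by
    refine isInternal_of_proj _
      (fun i => ((V.proj i).prodMap (W.proj i)).restrict fun z hz => ?_) ?_ ?_ ?_
    · have hz' : f.toLin z.1 = g.toLin z.2 := hz
      show f.toLin (V.proj i z.1) = g.toLin (W.proj i z.2)
      rw [f.map_proj, g.map_proj, hz']
    · rintro i ⟨⟨x, y⟩, h⟩ ⟨hx, hy⟩
      exact Subtype.ext (Prod.ext (V.proj_of_mem hx) (W.proj_of_mem hy))
    · rintro i j hij ⟨⟨x, y⟩, h⟩ ⟨hx, hy⟩
      exact Subtype.ext (Prod.ext (V.proj_of_mem_ne hij hx) (W.proj_of_mem_ne hij hy))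
    · rintro ⟨⟨x, y⟩, h⟩
      classical
      obtain ⟨s, hs⟩ := V.exists_sum_proj x
      obtain ⟨s', hs'⟩ := W.exists_sum_proj y
      have h' : f.toLin x = g.toLin y := h
      have hm : ∀ i, (V.proj i x, W.proj i y) ∈ LinearMap.eqLocus
          (f.toLin ∘ₗ LinearMap.fst K _ _) (g.toLin ∘ₗ LinearMap.snd K _ _) := fun i => by
        show f.toLin (V.proj i x) = g.toLin (W.proj i y)
        rw [f.map_proj, g.map_proj, h']
      have e : (⟨(x, y), h⟩ : LinearMap.eqLocus (f.toLin ∘ₗ LinearMap.fst K _ _)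
          (g.toLin ∘ₗ LinearMap.snd K _ _)) = ∑ i ∈ s ∪ s', ⟨(V.proj i x, W.proj i y), hm i⟩ := by
        refine Subtype.ext (Prod.ext ?_ ?_)
        · simp [Prod.fst_sum, hs _ Finset.subset_union_left]
        · simp [Prod.snd_sum, hs' _ Finset.subset_union_right]
      rw [e]
      exact Submodule.sum_mem _ fun i _ => Submodule.mem_iSup_of_mem i
        ⟨V.proj_mem i x, W.proj_mem i y⟩
  d := (V.d.prodMap W.d).restrict fun z hz => by
    have hz' : f.toLin z.1 = g.toLin z.2 := hz
    show f.toLin (V.d z.1) = g.toLin (W.d z.2)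
    rw [f.map_d, g.map_d, hz']
  d_mem := fun h => ⟨V.d_mem h.1, W.d_mem h.2⟩
  d_d := fun z => Subtype.ext (Prod.ext (V.d_d _) (W.d_d _))

end DGModule

/-! ### Path objects and the mapping path object. -/

namespace DGLA

variable {K : Type k} [Field K]

/-- The bracket `[x tᵖ, y t^q] = [x, y] t^(p+q)` on polynomials. -/
def polyBracket (L : DGLA.{k, u} K) :
    (ℕ →₀ L.carrier) →ₗ[K] (ℕ →₀ L.carrier) →ₗ[K] (ℕ →₀ L.carrier) :=
  Finsupp.lsum K fun p =>
    (Finsupp.lsum K fun q => (L.bracket.compr₂ (Finsupp.lsingle (p + q))).flip).flip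

@[simp]
theorem polyBracket_single (L : DGLA.{k, u} K) (p q : ℕ) (x y : L.carrier) :
    L.polyBracket (Finsupp.single p x) (Finsupp.single q y) =
      Finsupp.single (p + q) (L.bracket x y) := by
  simp [polyBracket]

theorem polyBracket_hom_ext {V W M : Type*} [AddCommGroup V] [Module K V] [AddCommGroup W]
    [Module K W] [AddCommGroup M] [Module K M] {f g : (ℕ →₀ V) →ₗ[K] (ℕ →₀ W) →ₗ[K] M}
    (h : ∀ p x q y, f (Finsupp.single p x) (Finsupp.single q y) =
      g (Finsupp.single p x) (Finsupp.single q y)) : f = g :=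
  Finsupp.lhom_ext fun p x => Finsupp.lhom_ext fun q y => h p x q y

/-- The differential graded Lie algebra `L[t]`. -/
@[reducible]
def poly (L : DGLA.{k, u} K) : DGLA.{k, u} K where
  toDGModule := L.toDGModule.poly
  bracket := L.polyBracket
  bracket_mem := by
    intro i j s t hs ht
    refine L.polyDeg_le (S := (L.polyDeg (i + j)).comap (L.polyBracket.flip t))
      (fun p x hx => ?_) hs
    refine L.polyDeg_le (S := (L.polyDeg (i + j)).comap (L.polyBracket (Finsupp.single p x)))
      (fun q y hy => ?_) ht
    simpa using L.single_mem_polyDeg (L.bracket_mem hx hy) (p + q)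
  bracket_skew := by
    intro i j s t hs ht
    refine L.eqOn_polyDeg (f := L.polyBracket.flip t + (-1 : K) ^ (i * j) • L.polyBracket t)
      (g := 0) (fun p x hx => ?_) hs
    refine L.eqOn_polyDeg (f := L.polyBracket (Finsupp.single p x) +
      (-1 : K) ^ (i * j) • L.polyBracket.flip (Finsupp.single p x)) (g := 0)
      (fun q y hy => ?_) ht
    simp [add_comm q p, ← Finsupp.single_add, L.bracket_skew hx hy]
  jacobi := by
    intro i j s t r hs ht
    refine L.eqOn_polyDeg (f := L.polyBracket.flip (L.polyBracket t r))
      (g := L.polyBracket.flip r ∘ₗ L.polyBracket.flip t +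
        (-1 : K) ^ (i * j) • L.polyBracket t ∘ₗ L.polyBracket.flip r) (fun p x hx => ?_) hs
    refine L.eqOn_polyDeg
      (f := L.polyBracket (Finsupp.single p x) ∘ₗ L.polyBracket.flip r)
      (g := L.polyBracket.flip r ∘ₗ L.polyBracket (Finsupp.single p x) +
        (-1 : K) ^ (i * j) • L.polyBracket.flip (L.polyBracket (Finsupp.single p x) r))
      (fun q y hy => ?_) ht
    refine LinearMap.congr_fun
      (f := L.polyBracket (Finsupp.single p x) ∘ₗ L.polyBracket (Finsupp.single q y))
      (g := L.polyBracket (L.polyBracket (Finsupp.single p x) (Finsupp.single q y)) +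
        (-1 : K) ^ (i * j) •
          L.polyBracket (Finsupp.single q y) ∘ₗ L.polyBracket (Finsupp.single p x))
      (Finsupp.lhom_ext fun o z => ?_) r
    simp [L.jacobi z hx hy, add_assoc, add_left_comm q p o]
  d_bracket := by
    intro i s t hs
    refine L.eqOn_polyDeg (f := L.toDGModule.poly.d ∘ₗ L.polyBracket.flip t)
      (g := L.polyBracket.flip t ∘ₗ L.toDGModule.poly.d +
        (-1 : K) ^ i • L.polyBracket.flip (L.toDGModule.poly.d t)) (fun p x hx => ?_) hs
    refine LinearMap.congr_fun (f := L.toDGModule.poly.d ∘ₗ L.polyBracket (Finsupp.single p x))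
      (g := L.polyBracket (L.toDGModule.poly.d (Finsupp.single p x)) +
        (-1 : K) ^ i • L.polyBracket (Finsupp.single p x) ∘ₗ L.toDGModule.poly.d)
      (Finsupp.lhom_ext fun q y => ?_) t
    simp [L.d_bracket y hx]

theorem polyDeriv_bracket (L : DGLA.{k, u} K) (s t : ℕ →₀ L.carrier) :
    L.polyDeriv (L.polyBracket s t) =
      L.polyBracket (L.polyDeriv s) t + L.polyBracket s (L.polyDeriv t) := by
  have : L.polyBracket.compr₂ L.polyDeriv =
      L.polyBracket ∘ₗ L.polyDeriv + L.polyBracket.compl₂ L.polyDeriv :=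
    polyBracket_hom_ext fun p x q y => by
      -- Zero exponents are separated because there `p - 1` or `q - 1` is truncated.
      rcases p with _ | p <;> rcases q with _ | q
      · simp
      · simp [← add_assoc]
      · simp
      · have e1 : p + 1 + (q + 1) - 1 = p + q + 1 := by omega
        have e2 : p + (q + 1) = p + q + 1 := by omega
        have e3 : p + 1 + q = p + q + 1 := by omega
        simp only [LinearMap.compr₂_apply, LinearMap.add_apply, LinearMap.comp_apply,
          LinearMap.compl₂_apply, polyBracket_single, DGModule.polyDeriv_single, map_smul,
          LinearMap.smul_apply, Nat.add_sub_cancel, e1, e2, e3, ← Finsupp.single_add]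
        congr 1
        push_cast
        module
  exact LinearMap.congr_fun₂ this s t

/-- The evaluation at `t = c` as a morphism of differential graded Lie algebras. -/
def polyEvalHom (L : DGLA.{k, u} K) (c : K) : Hom L.poly L where
  toHom := L.toDGModule.polyEvalHom c
  map_bracket := by
    intro s t
    refine LinearMap.congr_fun₂ (f := L.polyBracket.compr₂ (L.polyEval c))
      (g := L.bracket.compl₁₂ (L.polyEval c) (L.polyEval c))
      (polyBracket_hom_ext fun p x q y => ?_) s t
    simp [pow_add, smul_smul, mul_comm]

/-- The differential graded Lie algebra `L ⊗ K[dt]`, with differential twisted by a derivation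
`δ` of degree `0`. -/
@[reducible]
def extendForm (L : DGLA.{k, u} K) (δ : DGModule.Hom L.toDGModule L.toDGModule)
    (hδ : ∀ x y, δ.toLin (L.bracket x y) =
      L.bracket (δ.toLin x) y + L.bracket x (δ.toLin y)) : DGLA.{k, u} K where
  toDGModule := L.toDGModule.extendForm δ
  bracket := LinearMap.mk₂ K
    -- Moving `dt` to the right past the first component of `q` produces the sign; the bracket of
    -- the two form components vanishes since `dt² = 0`.
    (fun p q => (L.bracket p.1 q.1, L.bracket p.1 q.2 + L.bracket p.2 (L.sign q.1)))
    (fun p p' q => by simp; abel) (fun c p q => by simp)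
    (fun p q q' => by simp; abel) (fun c p q => by simp)
  bracket_mem := by
    rintro i j ⟨x, y⟩ ⟨x', y'⟩ ⟨hx, hy⟩ ⟨hx', hy'⟩
    refine ⟨L.bracket_mem hx hx', add_mem ?_ ?_⟩
    · have := L.bracket_mem hx hy'
      rwa [show i + (j - 1) = i + j - 1 by ring] at this
    · have := L.bracket_mem hy (L.sign_mem hx')
      rwa [show i - 1 + j = i + j - 1 by ring] at this
  bracket_skew := by
    rintro i j ⟨x, y⟩ ⟨x', y'⟩ ⟨hx, hy⟩ ⟨hx', hy'⟩
    dsimp at hx hy hx' hy'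
    refine Prod.ext (L.bracket_skew hx hx') ?_
    have h1 := eq_neg_of_add_eq_zero_left (L.bracket_skew hx hy')
    have h2 := eq_neg_of_add_eq_zero_left (L.bracket_skew hy hx')
    have e1 : (-1 : K) ^ (i * (j - 1)) = (-1) ^ (i * j) * (-1) ^ i := by
      rw [neg_one_zpow_mul]; exact neg_one_zpow_congr (r := -i) (by ring)
    have e2 : (-1 : K) ^ j * (-1 : K) ^ ((i - 1) * j) = (-1) ^ (i * j) := by
      rw [neg_one_zpow_mul]; exact neg_one_zpow_congr (r := 0) (by ring)
    simp only [LinearMap.mk₂_apply, Prod.snd_add, Prod.smul_snd, Prod.snd_zero, h1, h2,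
      L.sign_of_mem hx, L.sign_of_mem hx', map_smul, smul_neg, smul_smul, e1, e2, smul_add]
    abel
  jacobi := by
    rintro i j ⟨x, y⟩ ⟨x', y'⟩ ⟨x'', y''⟩ ⟨hx, hy⟩ ⟨hx', hy'⟩
    dsimp at hx hy hx' hy'
    refine Prod.ext (L.jacobi x'' hx hx') ?_
    have e1 : (-1 : K) ^ (i * (j - 1)) = (-1) ^ (i * j) * (-1) ^ i := by
      rw [neg_one_zpow_mul]; exact neg_one_zpow_congr (r := -i) (by ring)
    have e2 : (-1 : K) ^ j * (-1 : K) ^ ((i - 1) * j) = (-1) ^ (i * j) := by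
      rw [neg_one_zpow_mul]; exact neg_one_zpow_congr (r := 0) (by ring)
    simp only [LinearMap.mk₂_apply, Prod.snd_add, Prod.smul_snd, L.bracket_sign,
      L.sign_of_mem hx, L.sign_of_mem hx', map_smul, map_add, LinearMap.add_apply,
      LinearMap.smul_apply, L.jacobi _ hx hx', L.jacobi _ hx hy', L.jacobi _ hy hx',
      smul_smul, e1, e2, smul_add]
    abel
  d_bracket := by
    rintro i ⟨x, y⟩ ⟨x', y'⟩ ⟨hx, hy⟩
    dsimp at hx hy
    refine Prod.ext (L.d_bracket x' hx) ?_
    have e1 : (-1 : K) ^ (i - 1) = -(-1) ^ i := by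
      rw [zpow_sub₀ (neg_ne_zero.2 (one_ne_zero (α := K)))]; simp [div_neg]
    show L.d (L.bracket x y' + L.bracket y (L.sign x')) + L.sign (δ.toLin (L.bracket x x')) =
      L.bracket (L.d x) y' + L.bracket (L.d y + L.sign (δ.toLin x)) (L.sign x') +
        (-1 : K) ^ i • (L.bracket x (L.d y' + L.sign (δ.toLin x')) +
          L.bracket y (L.sign (L.d x')))
    simp only [L.bracket_sign, hδ, map_add, LinearMap.add_apply, L.d_bracket _ hx,
      L.d_bracket _ hy, L.d_sign, L.sign_of_mem hx, L.sign_of_mem (δ.map_deg hx), map_smul,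
      map_neg, LinearMap.smul_apply, e1, smul_add, neg_smul, smul_neg]
    abel

/-- The fibre product of differential graded Lie algebras. -/
@[reducible]
def fiberProduct {L N P : DGLA.{k, u} K} (f : Hom L N) (g : Hom P N) : DGLA.{k, u} K where
  toDGModule := DGModule.fiberProduct f.toHom g.toHom
  bracket := LinearMap.mk₂ K
    (fun z w => ⟨(L.bracket z.1.1 w.1.1, P.bracket z.1.2 w.1.2), by
      have hz : f.toLin z.1.1 = g.toLin z.1.2 := z.2
      have hw : f.toLin w.1.1 = g.toLin w.1.2 := w.2
      show f.toLin (L.bracket z.1.1 w.1.1) = g.toLin (P.bracket z.1.2 w.1.2)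
      rw [f.map_bracket, g.map_bracket, hz, hw]⟩)
    (fun z z' w => Subtype.ext (by simp)) (fun c z w => Subtype.ext (by simp))
    (fun z z' w => Subtype.ext (by simp)) (fun c z w => Subtype.ext (by simp))
  bracket_mem := fun hx hy => ⟨L.bracket_mem hx.1 hy.1, P.bracket_mem hx.2 hy.2⟩
  bracket_skew := fun hx hy =>
    Subtype.ext (Prod.ext (L.bracket_skew hx.1 hy.1) (P.bracket_skew hx.2 hy.2))
  jacobi := fun _ hx hy =>
    Subtype.ext (Prod.ext (L.jacobi _ hx.1 hy.1) (P.jacobi _ hx.2 hy.2))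
  d_bracket := fun _ hx =>
    Subtype.ext (Prod.ext (L.d_bracket _ hx.1) (P.d_bracket _ hx.2))

/-- The first projection of a fibre product. -/
def fiberProduct.fst {L N P : DGLA.{k, u} K} (f : Hom L N) (g : Hom P N) :
    Hom (fiberProduct f g) L where
  toLin := LinearMap.fst K _ _ ∘ₗ Submodule.subtype _
  map_deg := fun h => h.1
  map_d := fun _ => rfl
  map_bracket := fun _ _ => rfl

/-- The second projection of a fibre product. -/
def fiberProduct.snd {L N P : DGLA.{k, u} K} (f : Hom L N) (g : Hom P N) :
    Hom (fiberProduct f g) P where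
  toLin := LinearMap.snd K _ _ ∘ₗ Submodule.subtype _
  map_deg := fun h => h.2
  map_d := fun _ => rfl
  map_bracket := fun _ _ => rfl

/-- The path object `L[t, dt]`. -/
@[reducible]
def path (L : DGLA.{k, u} K) : DGLA.{k, u} K :=
  L.poly.extendForm L.polyDerivHom L.polyDeriv_bracket

/-- The evaluation of paths at `t = c`. -/
def pathEval (L : DGLA.{k, u} K) (c : K) : Hom L.path L where
  toLin := L.polyEval c ∘ₗ LinearMap.fst K _ _
  map_deg := fun h => (L.polyEvalHom c).map_deg h.1
  map_d := fun f => (L.polyEvalHom c).map_d f.1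
  map_bracket := fun f g => (L.polyEvalHom c).map_bracket f.1 g.1

/-- The mapping path object `{(x, f) ∈ L × N[t, dt] | φ(x) = f(0)}`. -/
@[reducible]
def mappingPath {L N : DGLA.{k, u} K} (φ : Hom L N) : DGLA.{k, u} K :=
  fiberProduct φ (N.pathEval 0)

/-- The inclusion of `L` into the mapping path object by constant paths. -/
def mappingPathConst {L N : DGLA.{k, u} K} (φ : Hom L N) : Hom L (mappingPath φ) where
  toLin := (LinearMap.prod LinearMap.id
    (LinearMap.inl K _ _ ∘ₗ Finsupp.lsingle 0 ∘ₗ φ.toLin)).codRestrict _ fun x => by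
      show φ.toLin x = N.polyEval 0 (Finsupp.single 0 (φ.toLin x))
      simp
  map_deg := fun h => ⟨h, N.single_mem_polyDeg (φ.map_deg h) 0, zero_mem _⟩
  map_d := fun x => Subtype.ext (Prod.ext rfl (Prod.ext
    (by
      show Finsupp.single 0 (φ.toLin (L.d x)) =
        Finsupp.mapRange.linearMap N.d (Finsupp.single 0 (φ.toLin x))
      simp [φ.map_d])
    (by
      show (0 : ℕ →₀ N.carrier) = N.poly.d 0 +
        N.poly.sign (N.polyDeriv (Finsupp.single 0 (φ.toLin x)))
      simp)))
  map_bracket := fun x y => Subtype.ext (Prod.ext rfl (Prod.ext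
    (by
      show Finsupp.single 0 (φ.toLin (L.bracket x y)) =
        N.polyBracket (Finsupp.single 0 (φ.toLin x)) (Finsupp.single 0 (φ.toLin y))
      simp [φ.map_bracket])
    (by
      show (0 : ℕ →₀ N.carrier) = N.polyBracket (Finsupp.single 0 (φ.toLin x)) 0 +
        N.polyBracket 0 (N.poly.sign (Finsupp.single 0 (φ.toLin y)))
      simp)))

end DGLA

/-! ### Contractions from acyclicity, and quasi-isomorphisms on cochains. -/

namespace DGModule

variable {K : Type k} [Field K]

/-- Every linear map has a generalized inverse. -/
theorem exists_generalizedInverse {V W : Type*} [AddCommGroup V] [Module K V] [AddCommGroup W]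
    [Module K W] (f : V →ₗ[K] W) : ∃ g : W →ₗ[K] V, ∀ x, f (g (f x)) = f x := by
  obtain ⟨s, hs⟩ := f.rangeRestrict.exists_rightInverse_of_surjective f.range_rangeRestrict
  obtain ⟨g, hg⟩ := s.exists_extend
  refine ⟨g, fun x => ?_⟩
  have h1 : g (f x) = s (f.rangeRestrict x) := LinearMap.congr_fun hg (f.rangeRestrict x)
  rw [h1]
  exact congrArg Subtype.val (LinearMap.congr_fun hs (f.rangeRestrict x))

/-- An acyclic kernel is contractible. -/
theorem Hom.exists_isKernelContraction {V : DGModule.{k, u} K} {W : DGModule.{k, v} K}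
    (p : Hom V W) (h : ∀ i, ∀ x ∈ V.deg i, p.toLin x = 0 → V.d x = 0 →
      ∃ y ∈ V.deg (i - 1), p.toLin y = 0 ∧ V.d y = x) : ∃ σ, p.IsKernelContraction σ := by
  let I : ℤ → Submodule K V.carrier := fun i => V.deg i ⊓ LinearMap.ker p.toLin
  -- Each `g i` inverts `d` on the coboundaries of the kernel. It is defined on all of `V` but takes
  -- values in the kernel, and so does `G`.
  choose g hg using fun i => exists_generalizedInverse (V.d ∘ₗ (I (i - 1)).subtype)
  let G : V.carrier →ₗ[K] V.carrier :=
    (DirectSum.toModule K ℤ V.carrier fun i =>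
      (I (i - 1)).subtype ∘ₗ g i ∘ₗ (V.deg i).subtype) ∘ₗ V.decomp.toLinearMap
  have hG : ∀ i, ∀ x ∈ V.deg i, G x = g i x := fun i x hx => by
    simp [G, V.decomp_of_mem hx]
  have hGdeg : ∀ i, ∀ x ∈ V.deg i, G x ∈ V.deg (i - 1) := fun i x hx => by
    rw [hG i x hx]; exact (g i x).2.1
  have hpG : ∀ x, p.toLin (G x) = 0 := fun x => LinearMap.congr_fun (f := p.toLin ∘ₗ G) (g := 0)
    (V.hom_ext fun i x hx => by
      rw [LinearMap.comp_apply, hG i x hx]; exact (g i x).2.2) x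
  have hdG : ∀ i, ∀ x ∈ V.deg i, p.toLin x = 0 → V.d x = 0 → V.d (G x) = x := by
    intro i x hx hpx hdx
    obtain ⟨y, hy, hpy, rfl⟩ := h i x hx hpx hdx
    rw [hG i _ hx]
    exact hg i ⟨y, hy, hpy⟩
  -- `G` inverts `d` only on cocycles. For `x` in the kernel `x - G(dx)` is a cocycle, so `σ = G(1 -
  -- Gd)` satisfies `dσ(x) = x - G(dx)` and `σ(dx) = G(dx)`.
  refine ⟨G ∘ₗ (LinearMap.id - G ∘ₗ V.d), fun {i x} hx => ?_, fun x => hpG _, fun x hx => ?_⟩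
  · exact hGdeg i _ (sub_mem hx (by simpa using hGdeg _ _ (V.d_mem hx)))
  · refine p.eqOn_ker (f := V.d ∘ₗ G ∘ₗ (LinearMap.id - G ∘ₗ V.d) +
      (G ∘ₗ (LinearMap.id - G ∘ₗ V.d)) ∘ₗ V.d) (g := LinearMap.id) (fun i x hx hpx => ?_) hx
    have hpd : p.toLin (V.d x) = 0 := by rw [p.map_d, hpx, map_zero]
    have h1 := hdG _ _ (V.d_mem hx) hpd (V.d_d x)
    have h2 := hdG i (x - G (V.d x)) (sub_mem hx (by simpa using hGdeg _ _ (V.d_mem hx)))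
      (by rw [map_sub, hpx, hpG, sub_zero]) (by rw [map_sub, h1, sub_self])
    simp only [LinearMap.add_apply, LinearMap.comp_apply, LinearMap.sub_apply,
      LinearMap.id_apply, V.d_d, map_zero, sub_zero, h2]
    abel

/-- Injectivity in cohomology, in terms of cochains. -/
theorem Hom.IsQuasiIso.exists_primitive {V : DGModule.{k, u} K} {W : DGModule.{k, v} K}
    {f : Hom V W} (hf : f.IsQuasiIso) {i : ℤ} {x : V.carrier} (hx : x ∈ V.deg i)
    (hdx : V.d x = 0) {y : W.carrier} (hy : y ∈ W.deg (i - 1)) (hxy : W.d y = f.toLin x) :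
    ∃ z ∈ V.deg (i - 1), V.d z = x := by
  have h0 : f.cohomologyMap i (Submodule.Quotient.mk ⟨x, hx, hdx⟩) = 0 := by
    rw [cohomologyMap, Submodule.mapQ_apply, Submodule.Quotient.mk_eq_zero]
    exact ⟨y, hy, hxy⟩
  have h1 := (hf i).1 (h0.trans (map_zero _).symm)
  rw [Submodule.Quotient.mk_eq_zero] at h1
  exact h1

/-- Surjectivity in cohomology, in terms of cochains. -/
theorem Hom.IsQuasiIso.exists_cocycle {V : DGModule.{k, u} K} {W : DGModule.{k, v} K}
    {f : Hom V W} (hf : f.IsQuasiIso) {i : ℤ} {y : W.carrier} (hy : y ∈ W.deg i)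
    (hdy : W.d y = 0) :
    ∃ x ∈ V.deg i, V.d x = 0 ∧ ∃ z ∈ W.deg (i - 1), y = f.toLin x + W.d z := by
  obtain ⟨c, hc⟩ := (hf i).2 (Submodule.Quotient.mk ⟨y, hy, hdy⟩)
  obtain ⟨⟨x, hx, hdx⟩, rfl⟩ := Submodule.Quotient.mk_surjective _ c
  rw [cohomologyMap, Submodule.mapQ_apply, eq_comm, Submodule.Quotient.eq] at hc
  obtain ⟨z, hz, hzy⟩ := hc
  refine ⟨x, hx, hdx, z, hz, ?_⟩
  rw [hzy]
  exact (add_sub_cancel (f.toLin x) y).symm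

/-- The hypothesis is the `dt` component of closedness of `f + g dt`. It says that the
`t`-derivative of `f` is `d` of `V.poly.sign g`, and integration in `t` commutes with `d`. -/
theorem d_polyInt_sign [CharZero K] (V : DGModule.{k, u} K) (f g : ℕ →₀ V.carrier)
    (h : V.poly.d g + V.poly.sign (V.polyDeriv f) = 0) :
    V.poly.d (V.polyInt (V.poly.sign g)) = f - Finsupp.single 0 (V.polyEval 0 f) := by
  have h1 : V.poly.d (V.polyInt (V.poly.sign g)) = V.polyInt (V.poly.d (V.poly.sign g)) :=
    (V.polyIntHom.map_d _).symm
  rw [h1, V.poly.d_sign, eq_neg_of_add_eq_zero_left h, map_neg, map_neg, map_neg, neg_neg,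
    V.poly.sign_sign, V.polyInt_polyDeriv]

end DGModule

/-! ### The two trivial fibrations and the conclusion. -/

namespace DGLA

variable {K : Type k} [Field K] {L N : DGLA.{k, u} K}

theorem Hom.ext_toLin {φ ψ : Hom L N} (h : φ.toLin = ψ.toLin) : φ = ψ := by
  obtain ⟨⟨_, _, _⟩, _⟩ := φ
  obtain ⟨⟨_, _, _⟩, _⟩ := ψ
  cases h
  rfl

/-- Constant paths give surjectivity. The kernel consists of the paths starting at `0`, and
integrating the `dt` component from `t = 0` contracts it; the primitive vanishes at `0`, so it stays
in the kernel. -/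
theorem mappingPath_fst_isTrivialFibration [CharZero K] (φ : Hom L N) :
    (fiberProduct.fst φ (N.pathEval 0)).toHom.IsTrivialFibration := by
  refine ⟨fun x => ⟨(mappingPathConst φ).toLin x, rfl⟩, ?_⟩
  let S : (ℕ →₀ N.carrier) →ₗ[K] (ℕ →₀ N.carrier) := N.polyInt ∘ₗ N.poly.sign
  let T : (mappingPath φ).carrier →ₗ[K] (mappingPath φ).carrier :=
    (LinearMap.inr K _ _ ∘ₗ LinearMap.inl K _ _ ∘ₗ S ∘ₗ LinearMap.snd K _ _ ∘ₗ
      LinearMap.snd K _ _ ∘ₗ Submodule.subtype _).codRestrict _ fun z => by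
        show φ.toLin 0 = N.polyEval 0 (N.polyInt (N.poly.sign z.1.2.2))
        rw [N.polyEval_zero_polyInt, map_zero]
  refine ⟨T, fun {i z} hz => ⟨zero_mem _, ?_, zero_mem _⟩, fun z => rfl, ?_⟩
  · exact N.polyIntHom.map_deg (N.poly.sign_mem hz.2.2)
  · rintro ⟨⟨l, f, g⟩, h⟩ hz
    have hl : l = 0 := hz
    subst hl
    have hf0 : N.polyEval 0 f = 0 := by
      have : φ.toLin 0 = N.polyEval 0 f := h
      rw [← this, map_zero]
    refine Subtype.ext (Prod.ext ?_ (Prod.ext ?_ ?_))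
    · show L.d 0 + 0 = 0
      simp
    · show N.poly.d (N.polyInt (N.poly.sign g)) +
        N.polyInt (N.poly.sign (N.poly.d g + N.poly.sign (N.polyDeriv f))) = f
      have h1 : N.poly.d (N.polyInt (N.poly.sign g)) = N.polyInt (N.poly.d (N.poly.sign g)) :=
        (N.polyIntHom.map_d _).symm
      rw [h1, N.poly.d_sign, map_add, N.poly.sign_sign, map_add, N.polyInt_polyDeriv, hf0, map_neg]
      simp
    · show N.poly.d 0 + N.poly.sign (N.polyDeriv (N.polyInt (N.poly.sign g))) + 0 = g
      rw [N.polyDeriv_polyInt, N.poly.sign_sign]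
      simp

/-- The end point of a path in the mapping path object. -/
def mappingPathEnd (φ : Hom L N) : Hom (mappingPath φ) N :=
  (N.pathEval 1).comp (fiberProduct.snd φ (N.pathEval 0))

/-- The path `t n` ends at `n`, which gives surjectivity. The kernel is the homotopy fibre of `φ`,
so it is acyclic, hence contractible over a field. -/
theorem mappingPathEnd_isTrivialFibration [CharZero K] (φ : Hom L N) (hφ : φ.IsQuasiIso) :
    (mappingPathEnd φ).toHom.IsTrivialFibration := by
  constructor
  · intro n
    refine ⟨⟨(0, (Finsupp.single 1 n, 0)), ?_⟩, ?_⟩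
    · show φ.toLin 0 = N.polyEval 0 (Finsupp.single 1 n)
      simp
    · show N.polyEval 1 (Finsupp.single 1 n) = n
      simp
  · refine DGModule.Hom.exists_isKernelContraction _ ?_
    rintro i ⟨⟨l, f, g⟩, h⟩ ⟨hl, hf, hg⟩ hz hd
    have h0 : φ.toLin l = N.polyEval 0 f := h
    have hf1 : N.polyEval 1 f = 0 := hz
    have hdl : L.d l = 0 := congrArg (fun z => z.1.1) hd
    have hdg : N.poly.d g + N.poly.sign (N.polyDeriv f) = 0 := congrArg (fun z => z.1.2.2) hd
    have hdF := N.d_polyInt_sign f g hdg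
    have hF0 := N.polyEval_zero_polyInt (N.poly.sign g)
    have hδF := N.polyDeriv_polyInt (N.poly.sign g)
    have hFdeg : N.polyInt (N.poly.sign g) ∈ N.polyDeg (i - 1) :=
      N.polyIntHom.map_deg (N.poly.sign_mem hg)
    set F := N.polyInt (N.poly.sign g) with hF
    have hF1deg : N.polyEval 1 F ∈ N.deg (i - 1) := (N.polyEvalHom 1).map_deg hFdeg
    have hdF1 : N.d (N.polyEval 1 F) = -φ.toLin l := by
      have : N.polyEval 1 (N.poly.d F) = N.d (N.polyEval 1 F) := (N.polyEvalHom 1).map_d F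
      rw [← this, hdF, map_sub, hf1, DGModule.polyEval_single, ← h0]
      simp
    -- Evaluating `dF = f - f(0)` at `t = 1`, where `f` vanishes, shows that `φ l` is the
    -- differential of `-F(1)`.
    obtain ⟨k₀, hk₀, rfl⟩ := hφ.exists_primitive hl hdl (neg_mem hF1deg)
      (by rw [map_neg, hdF1, neg_neg]; rfl)
    -- The path `F + φ(k₀)` bounds `f` but may end at a nonzero cocycle; up to the exact term `dm`,
    -- the cocycle `k₁` corrects this.
    obtain ⟨k₁, hk₁, hdk₁, m, hm, e⟩ := hφ.exists_cocycle
      (y := -N.polyEval 1 F - φ.toLin k₀) (sub_mem (neg_mem hF1deg) (φ.map_deg hk₀))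
      (by rw [map_sub, map_neg, hdF1, neg_neg, φ.map_d, sub_self])
    have hdm : N.d m ∈ N.deg (i - 1) := by simpa using N.d_mem hm
    have hk : k₀ + k₁ ∈ L.deg (i - 1) := add_mem hk₀ hk₁
    -- The term `t dm` makes the path end at `0`; the `dt` component `N.sign m` cancels the
    -- contribution of its `t`-derivative to the differential.
    refine ⟨⟨(k₀ + k₁, (F + Finsupp.single 0 (φ.toLin (k₀ + k₁)) + Finsupp.single 1 (N.d m),
      Finsupp.single 0 (N.sign m))), ?_⟩, ⟨hk, ?_, ?_⟩, ?_, Subtype.ext (Prod.ext ?_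
        (Prod.ext ?_ ?_))⟩
    · show φ.toLin (k₀ + k₁) = N.polyEval 0 (F + _ + _)
      simp [hF0]
    · exact add_mem (add_mem hFdeg (N.single_mem_polyDeg (φ.map_deg hk) 0))
        (N.single_mem_polyDeg hdm 1)
    · exact N.single_mem_polyDeg (N.sign_mem hm) 0
    · show N.polyEval 1 (F + _ + _) = 0
      have e' : N.polyEval 1 F = -(φ.toLin k₁ + N.d m + φ.toLin k₀) := by
        rw [eq_neg_iff_add_eq_zero,
          ← show -N.polyEval 1 F - φ.toLin k₀ = φ.toLin k₁ + N.d m from e]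
        abel
      simp only [map_add, DGModule.polyEval_single, e', one_pow, one_smul]
      abel
    · show L.d (k₀ + k₁) = L.d k₀
      rw [map_add, hdk₁, add_zero]
    · show N.poly.d (F + _ + _) = f
      have h2 : N.d (φ.toLin (k₀ + k₁)) = N.polyEval 0 f := by
        rw [← φ.map_d, map_add, hdk₁, add_zero, h0]
      rw [map_add, map_add, hdF]
      simp [h2, N.d_d, -map_add]
    · show N.poly.d (Finsupp.single 0 (N.sign m)) + N.poly.sign (N.polyDeriv (F + _ + _)) = g
      rw [map_add N.polyDeriv, map_add N.polyDeriv, hδF, map_add, map_add, N.poly.sign_sign]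
      simp [N.poly_sign_single, N.d_sign]

theorem DefSet.map_comp {L M N : DGLA.{k, u} K} (ψ : Hom M N) (φ : Hom L M)
    (A : NilpDGA.{k, w} K) :
    DefSet.map (ψ.comp φ) (𝟙 A) = DefSet.map ψ (𝟙 A) ∘ DefSet.map φ (𝟙 A) := by
  funext x
  induction x using Quot.ind with | mk x =>
  refine congrArg (Quot.mk _) (Subtype.ext ?_)
  exact LinearMap.congr_fun
    (TensorProduct.map_comp ψ.toLin LinearMap.id φ.toLin LinearMap.id) _

theorem DefSet.map_id_bijective (L : DGLA.{k, u} K) (A : NilpDGA.{k, w} K) :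
    Function.Bijective (DefSet.map (Hom.id L) (𝟙 A)) := by
  convert Function.bijective_id
  funext x
  induction x using Quot.ind with | mk x =>
  refine congrArg (Quot.mk _) (Subtype.ext ?_)
  exact LinearMap.congr_fun TensorProduct.map_id _

/-- A quasi-isomorphism induces a bijection on deformations. -/
theorem DefSet.map_bijective_of_isQuasiIso [CharZero K] (φ : Hom L N) (hφ : φ.IsQuasiIso)
    (A : NilpDGA.{k, w} K) : Function.Bijective (DefSet.map φ (𝟙 A)) := by
  have h1 := DefSet.map_bijective_of_isTrivialFibration _
    (mappingPath_fst_isTrivialFibration φ) A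
  have h2 := DefSet.map_bijective_of_isTrivialFibration _
    (mappingPathEnd_isTrivialFibration φ hφ) A
  have e1 : (fiberProduct.fst φ (N.pathEval 0)).comp (mappingPathConst φ) = Hom.id L := rfl
  have e2 : (mappingPathEnd φ).comp (mappingPathConst φ) = φ := by
    refine Hom.ext_toLin (LinearMap.ext fun x => ?_)
    show N.polyEval 1 (Finsupp.single 0 (φ.toLin x)) = φ.toLin x
    simp
  have h3 := DefSet.map_id_bijective L A
  rw [← e1, DefSet.map_comp] at h3
  rw [← e2, DefSet.map_comp]
  -- The projection and its composite with the constant paths are bijective on deformations, so the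
  -- constant paths are too.
  exact h2.comp ((Function.Bijective.of_comp_iff' h1 _).1 h3)

end DGLA

end

theorem corollary3p5 {K : Type k} [Field K] [CharZero K] {L N : DGLA.{k, u} K}
    (φ : DGLA.Hom L N) (hφ : φ.IsQuasiIso) :
    CategoryTheory.IsIso (DGLA.Hom.defMap.{k, u, w} φ) := by
  rw [NatTrans.isIso_iff_isIso_app]
  intro A
  rw [isIso_iff_bijective]
  exact DGLA.DefSet.map_bijective_of_isQuasiIso φ hφ A
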